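/- **Setting.** Let $G=(V,E)$ be a finite directed acyclic network (parallel edges allowed, numbered consecutively from the first) with source $s$ and receiver $r\ne s$. No edge enters $s$, every node has a path to $r$, every node other than $s,r$ has out-degree at least $2$, and exactly $C$ edges enter $r$; these are known to $r$. Let $\mathbb F_q$ be a finite field. *Weak common randomness.* Each node $v$ has a code-book $\mathcal R_v$ with one entry for each pair (potential edge $e$ into $v$, potential edge $e'$ out of $v$). All entries are independent and uniform on $\mathbb F_q$ and known to $r$. The coding coefficient $\beta(e,v,e')$ used at $v$ is that entry. *Impulse response vectors (IRVs).* $\mathrm{IRV}(e)\in\mathbb F_q^C$ is a distinct unit vector for each edge $e$ into $r$, and $\mathrm{IRV}(e)=\sum_{e'}\beta(e,v,e')\,\mathrm{IRV}(e')$, over the edges $e'$ leaving $v$, for an edge $e$ into $v\neq r$. *Candidate set.* There are $t\le\kappa|E|\log|E|$ source generations. In generation $i$ the receiver gets $Y(i)=T(i)[I,M(i)]+\sum_{e\in E}\mathrm{IRV}(e)\,z_i(e)$, where $T(i)$ is the transform matrix from the source, $M(i)$ is the message, which has been decoded and is known to $r$, and $z_i(e)$ is the error packet on $e$. The source encoding,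 the messages and the errors may have any joint distribution which, given the code-book entries that $G$ uses, does not depend on the entries that $G$ does not use (for example, they may be independent of the code-books). Write $Y_h$ for the first $C$ columns of $Y$ and $Y_m$ for the others. The candidate set $\mathcal I$ (the output of FIND-IRV) is the set of all one-dimensional intersections of the column spaces of $Y_m(i)-Y_h(i)M(i)$ and $Y_m(j)-Y_h(j)M(j)$, $i<j$. *FIND-TOPO* has inputs $\mathcal I$ (a spanning vector for each line), the code-books and the edges into $r$. It starts with the graph $\tilde G$ whose nodes are $r$, $s$ and the tails of the edges into $r$, and whose edges are the edges into $r$. It repeats rounds until a round finds no new edge. In a round, for each node $v\ne s$ of $\tilde G$ whose outgoing edges in $\tilde G$ have IRVs (computed in $\tilde G$) of rank greater than $1$, it goes through the candidate edges $e=(u,v)\notin\tilde G$ (parallel edges in order: the next one is a candidate once the previous ones have been found). It computes $x=\sum_{e'}\beta(e,v,e')\,\mathrm{IRV}_{\tilde G}(e')$ over the edges $e'$ of $\tilde G$ leaving $v$. If the line $\langle x\rangle$ is in $\mathcal I$, it adds $e$ and $u$ to $\tilde G$ and recomputes the IRVs in $\tilde G$. Its cost is the number of additions, multiplications and equality tests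 in $\mathbb F_q$. **Theorem.** For every $\kappa>0$ there is a constant $K>0$, depending only on $\kappa$, such that for all data as above, with $\delta=K\log^2(|E|)\,|E|^4\,|V|/q$: let $A$ be the event that $\mathcal I$ contains the line $\langle\mathrm{IRV}(e)\rangle$ for every $e\in E$, and let $S$ be the event that FIND-TOPO outputs exactly $G$ (all nodes and all edges) and performs at most $K\log^2(|E|)\,|E|^4\,|V|\,C$ operations over $\mathbb F_q$. Then with probability at least $1-\delta$ the implication $A\Rightarrow S$ holds; consequently, if $\Pr(A)>0$, then $\Pr(S\mid A)\ge 1-\delta/\Pr(A)$. -/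

import Mathlib

open scoped Matrix

namespace FindTopo

/-! ### Networks, code-books and impulse response vectors -/

/-- `(u, v, i)` is the `i`-th parallel edge from node `u` to node `v`.
Nodes are named by their identification numbers in `Fin N`. -/
abbrev Edge (N m : ℕ) := Fin N × Fin N × Fin m

namespace Edge
variable {N m : ℕ}
/-- The node that the edge leaves. -/
def src (e : Edge N m) : Fin N := e.1
/-- The node that the edge enters. -/
def dst (e : Edge N m) : Fin N := e.2.1
/-- The number of the edge among the parallel edges with the same end nodes. -/
def num (e : Edge N m) : Fin m := e.2.2
end Edge

/-- `v` is a direct successor of `u`. -/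
def Adj {N m : ℕ} (E : Finset (Edge N m)) (u v : Fin N) : Prop := ∃ i, (u, v, i) ∈ E

/-- An acyclic network with source `s` and receiver `r`, in which every internal node has
out-degree at least two. `C` is the number of edges that enter the receiver, and `port j` is the
tail and the parallel number of the `j`-th of them. -/
structure Network (N m C : ℕ) where
  s : Fin N
  r : Fin N
  edges : Finset (Edge N m)
  port : Fin C → Fin N × Fin m
  s_ne_r : s ≠ r
  acyclic : ∀ v, ¬ Relation.TransGen (Adj edges) v v
  reach : ∀ v, Relation.ReflTransGen (Adj edges) v r
  source_no_in : ∀ u i, (u, s, i) ∉ edges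
  /-- Parallel edges are numbered consecutively from `0`. -/
  numbered : ∀ u v i j, (u, v, i) ∈ edges → j < i → (u, v, j) ∈ edges
  port_injective : Function.Injective port
  mem_port : ∀ u i, (u, r, i) ∈ edges ↔ ∃ j, port j = (u, i)
  weakly_connected : ∀ v, v ≠ s → v ≠ r → 2 ≤ (edges.filter fun e => e.src = v).card

/-- The local random code-books under weak type common randomness: `R v (u, i) (w, j)` is the
entry of node `v` for the coefficient from edge `(u, v, i)` to edge `(v, w, j)`. -/
abbrev Codebook (N m : ℕ) (F : Type) := Fin N → Fin N × Fin m → Fin N × Fin m → F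

section
variable {N m C : ℕ} {F : Type}

/-- The local coding coefficient from `e` to `e'` at the node that `e` enters
(used only when `e'` leaves that node). -/
def coef (R : Codebook N m F) (e e' : Edge N m) : F := R e.dst (e.src, e.num) (e'.dst, e'.num)

/-- The unit vector of an edge that enters the receiver. -/
def unitVec [Zero F] [One F] (port : Fin C → Fin N × Fin m) (e : Edge N m) : Fin C → F :=
  fun j => if port j = (e.src, e.num) then 1 else 0

/-- The recursion for impulse response vectors, cut off at paths of `k` edges. -/
def irvAux [Field F] (r : Fin N) (port : Fin C → Fin N × Fin m) (E : Finset (Edge N m))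
    (R : Codebook N m F) : ℕ → Edge N m → Fin C → F
  | 0, _ => 0
  | k + 1, e =>
    if e.dst = r then unitVec port e
    else ∑ e' ∈ E.filter (fun e' => e'.src = e.dst), coef R e e' • irvAux r port E R k e'

/-- The impulse response vector of an edge: a unit vector for an edge into the receiver, and
`∑ β(e, v, e') IRV(e')` over the edges `e'` out of `v` for an edge `e` into another node `v`.
A path of an acyclic graph on `N` nodes has fewer than `N` edges. -/
def Network.irv [Field F] (G : Network N m C) (R : Codebook N m F) (e : Edge N m) : Fin C → F :=
  irvAux G.r G.port G.edges R N e

/-- The coding coefficients that the network really uses; all other entries are blanked. -/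
def Network.used [Zero F] (G : Network N m C) (R : Codebook N m F) : Codebook N m F :=
  fun v a b => if (a.1, v, a.2) ∈ G.edges ∧ (v, b.1, b.2) ∈ G.edges then R v a b else 0

/-! ### Transmissions and the set of candidate impulse response vectors -/

/-- One source generation with packets of length `C + k`: the coefficients with which the source
encodes, the message `M` (the source matrix is `[I, M]`), and the packet that is added to the
content of each edge (zero on an edge without error). -/
structure Generation (N m C k : ℕ) (F : Type) where
  enc : Edge N m → Fin C → F
  msg : Matrix (Fin C) (Fin k) F
  err : Edge N m → Fin C ⊕ Fin k → F

variable {k t : ℕ}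

/-- The overall transform matrix from the source to the receiver. -/
def Network.transform [Field F] (G : Network N m C) (R : Codebook N m F)
    (g : Generation N m C k F) : Matrix (Fin C) (Fin C) F :=
  ∑ e ∈ G.edges.filter (fun e => e.src = G.s), Matrix.vecMulVec (G.irv R e) (g.enc e)

/-- The matrix that the receiver gets: `T [I, M]` plus the error matrix `∑ IRV(e) z(e)`. -/
def Network.received [Field F] (G : Network N m C) (R : Codebook N m F)
    (g : Generation N m C k F) : Matrix (Fin C) (Fin C ⊕ Fin k) F :=
  G.transform R g * Matrix.fromCols 1 g.msg
    + ∑ e ∈ G.edges, Matrix.vecMulVec (G.irv R e) (g.err e)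

open Classical in
/-- **FIND-IRV**: from the received matrices `Y i` and the decoded messages `M i`, the set of all
one-dimensional intersections of two of the column spaces of `Y_m - Y_h M`. -/
noncomputable def findIRV [Field F] (Y : Fin t → Matrix (Fin C) (Fin C ⊕ Fin k) F)
    (M : Fin t → Matrix (Fin C) (Fin k) F) : Finset (Submodule F (Fin C → F)) :=
  let W : Fin t → Submodule F (Fin C → F) := fun i =>
    Submodule.span F (Set.range ((Y i).toCols₂ - (Y i).toCols₁ * M i).col)
  ((Finset.univ.filter fun p : Fin t × Fin t => p.1 < p.2).image
    fun p => W p.1 ⊓ W p.2).filter fun L => Module.finrank F L = 1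

/-- The candidate set after `t` generations whose messages have been decoded. -/
noncomputable def Network.cand [Field F] (G : Network N m C) (R : Codebook N m F)
    (g : Fin t → Generation N m C k F) : Finset (Submodule F (Fin C → F)) :=
  findIRV (fun i => G.received R (g i)) (fun i => (g i).msg)

/-- The candidate set contains the lines spanned by the IRVs of all edges. -/
def Network.CandComplete [Field F] (G : Network N m C) (R : Codebook N m F)
    (g : Fin t → Generation N m C k F) : Prop :=
  ∀ e ∈ G.edges, Submodule.span F {G.irv R e} ∈ G.cand R g

open Classical in
/-- A vector that spans a given line. -/
noncomputable def generator [Field F] (L : Submodule F (Fin C → F)) : Fin C → F :=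
  if h : ∃ x, Submodule.span F {x} = L then h.choose else 0

/-- A finite set of lines, stored as a list with one spanning vector for each line. -/
noncomputable def encode [Field F] (S : Finset (Submodule F (Fin C → F))) :
    List (Fin C → F) :=
  S.toList.map generator

end

/-! ### Computations that count operations over the field -/

/-- A result together with the number of field operations (additions, multiplications and
equality tests of scalars) spent on it. -/
structure Ops (α : Type) where
  val : α
  cost : ℕ

instance : Monad Ops where
  pure a := ⟨a, 0⟩
  bind x f := ⟨(f x.val).val, x.cost + (f x.val).cost⟩

section
variable {C : ℕ} {F : Type}

/-- Vector addition: `C` additions. -/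
def vadd [Field F] (x y : Fin C → F) : Ops (Fin C → F) := ⟨x + y, C⟩

/-- Scalar multiple of a vector: `C` multiplications. -/
def vsmul [Field F] (a : F) (x : Fin C → F) : Ops (Fin C → F) := ⟨a • x, C⟩

/-- Equality of vectors: `C` tests. -/
def veq [DecidableEq F] (x y : Fin C → F) : Ops Bool := ⟨decide (x = y), C⟩

/-- The first nonzero coordinate, if there is one: `C` tests. -/
def pivot [Field F] [DecidableEq F] (x : Fin C → F) : Ops (Option (Fin C)) :=
  ⟨(List.finRange C).find? fun j => decide (x j ≠ 0), C⟩

/-- Are `h` and `x` linearly dependent? -/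
def dependent [Field F] [DecidableEq F] (h x : Fin C → F) : Ops Bool := do
  match ← pivot h with
  | none => pure true
  | some j =>
    let y ← vsmul (h j) x
    let z ← vsmul (x j) h
    veq y z

/-- Does the list of vectors have rank greater than one? -/
def rankGtOne [Field F] [DecidableEq F] (l : List (Fin C → F)) : Ops Bool :=
  l.anyM fun h => l.anyM fun x => do
    let b ← dependent h x
    pure !b

/-- Is the span of `x` one of the lines spanned by the (nonzero) vectors in `cands`? -/
def inCands [Field F] [DecidableEq F] (cands : List (Fin C → F)) (x : Fin C → F) : Ops Bool :=
  cands.anyM fun h => do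
    match ← pivot x with
    | none => pure false
    | some _ => dependent h x

end

/-! ### FIND-TOPO -/

/-- The topology found so far, the IRVs of its edges, and the flag STATE(New-Edge). -/
structure State (N m C : ℕ) (F : Type) where
  nodes : Finset (Fin N)
  edges : Finset (Edge N m)
  irvs : Edge N m → Fin C → F
  newEdge : Bool

section
variable {N m C : ℕ} {F : Type}

/-- The edges of `E` in a fixed order. -/
def edgeList (E : Finset (Edge N m)) : List (Edge N m) :=
  ((List.finRange N).flatMap fun u => (List.finRange N).flatMap fun v =>
    (List.finRange m).map fun i => (u, v, i)).filter fun e => decide (e ∈ E)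

/-- The edges of `E` that leave `v`. -/
def outEdges (E : Finset (Edge N m)) (v : Fin N) : List (Edge N m) :=
  (edgeList E).filter fun e => decide (e.src = v)

/-- `∑ β(e, v, e') f(e')` over the edges `e'` in the list `outs`. -/
def combine [Field F] (R : Codebook N m F) (f : Edge N m → Fin C → F) (e : Edge N m)
    (outs : List (Edge N m)) : Ops (Fin C → F) :=
  outs.foldlM (fun acc e' => do
    let y ← vsmul (coef R e e') (f e')
    vadd acc y) 0

/-- The unit vectors on the edges into the receiver, zero elsewhere. -/
def initIRV [Field F] (r : Fin N) (port : Fin C → Fin N × Fin m) (e : Edge N m) : Fin C → F :=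
  if e.dst = r then unitVec port e else 0

/-- One sweep of the IRV recursion over all edges of `E`. -/
def sweep [Field F] (r : Fin N) (R : Codebook N m F) (E : Finset (Edge N m))
    (f : Edge N m → Fin C → F) : Ops (Edge N m → Fin C → F) :=
  (edgeList E).foldlM (fun g e =>
    if e.dst = r then pure g else do
      let x ← combine R f e (outEdges E e.dst)
      pure (Function.update g e x)) f

/-- The IRVs of the edges of the graph `E`, computed with `N` sweeps. -/
def computeIRVs [Field F] (r : Fin N) (port : Fin C → Fin N × Fin m) (R : Codebook N m F)
    (E : Finset (Edge N m)) : Ops (Edge N m → Fin C → F) :=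
  (List.range N).foldlM (fun f _ => sweep r R E f) (initIRV r port)

variable [Field F] [DecidableEq F] (s r : Fin N) (port : Fin C → Fin N × Fin m)
  (cands : List (Fin C → F)) (R : Codebook N m F)

/-- Step D, `CheckIRV(v, e)`. -/
def checkIRV (v : Fin N) (e : Edge N m) (st : State N m C F) : Ops (State N m C F) := do
  let x ← combine R st.irvs e (outEdges st.edges v)
  let ok ← inCands cands x
  if ok then
    let E := insert e st.edges
    let f ← computeIRVs r port R E
    pure { nodes := insert e.src st.nodes, edges := E, irvs := f, newEdge := true }
  else pure st

/-- Step C, `FindNewEdge(v)`. The parallel edges from `u` to `v` are tried in order: `(u, v, i)` is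
a candidate once all `(u, v, j)` with `j < i` have been found. -/
def findNewEdge (v : Fin N) (st : State N m C F) : Ops (State N m C F) := do
  let big ← rankGtOne ((outEdges st.edges v).map st.irvs)
  if big then
    ((List.finRange N).flatMap fun u => (List.finRange m).map fun i => (u, i)).foldlM
      (fun (st : State N m C F) (a : Fin N × Fin m) =>
        if a.1 ≠ v ∧ (a.1, v, a.2) ∉ st.edges ∧ ∀ j < a.2, (a.1, v, j) ∈ st.edges
        then checkIRV r port cands R v (a.1, v, a.2) st else pure st) st
  else pure st

/-- One round of the loop in Step B. -/
def stepB (st : State N m C F) : Ops (State N m C F) :=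
  ((List.finRange N).filter fun v => decide (v ∈ st.nodes ∧ v ≠ s)).foldlM
    (fun st v => findNewEdge r port cands R v st) { st with newEdge := false }

/-- Step B is repeated until a round finds no new edge (at most `fuel` times). -/
def loopB : ℕ → State N m C F → Ops (State N m C F)
  | 0, st => pure st
  | fuel + 1, st => do
    let st' ← stepB s r port cands R st
    if st'.newEdge then loopB fuel st' else pure st'

/-- Step A: the receiver, its upstream neighbours, the source, and the edges into the receiver. -/
def initState : State N m C F where
  nodes := insert r (insert s (Finset.univ.image fun j => (port j).1))
  edges := Finset.univ.image fun j => ((port j).1, r, (port j).2)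
  irvs := initIRV r port
  newEdge := false

/-- **FIND-TOPO**. Every round of Step B but the last adds one of `N * N * m` possible edges, so
the bound on the number of rounds is never what ends the loop. -/
def findTopo : Ops (State N m C F) :=
  loopB s r port cands R (N * N * m + 1) (initState s r port)

end

/-! ### The probability space -/

section
variable {N m C k t : ℕ} {F : Type}

/-- The code-book entries are independent and uniform. The messages, the source encoding and the
errors have an arbitrary distribution `noise`, which may depend on the coding coefficients that the
network uses, but not on the code-book entries that it does not use. -/
noncomputable def Network.law [Field F] [Fintype F] (G : Network N m C)
    (noise : Codebook N m F → PMF (Fin t → Generation N m C k F)) :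
    PMF (Codebook N m F × (Fin t → Generation N m C k F)) :=
  (PMF.uniformOfFintype (Codebook N m F)).bind fun R => (noise (G.used R)).map (Prod.mk R)

/-- The run of FIND-TOPO on the candidate set and the code-books. -/
noncomputable def Network.run [Field F] [DecidableEq F] (G : Network N m C)
    (ω : Codebook N m F × (Fin t → Generation N m C k F)) : Ops (State N m C F) :=
  findTopo G.s G.r G.port (encode (G.cand ω.1 ω.2)) ω.1

/-- The event that the candidate set contains the lines of all edge IRVs. -/
def Network.completeEvent [Field F] (G : Network N m C) :
    Set (Codebook N m F × (Fin t → Generation N m C k F)) :=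
  {ω | G.CandComplete ω.1 ω.2}

/-- The event that FIND-TOPO outputs exactly the nodes and the edges of the network, with at most `B`
operations over the field. -/
def Network.recoverEvent [Field F] [DecidableEq F] (G : Network N m C) (B : ℝ) :
    Set (Codebook N m F × (Fin t → Generation N m C k F)) :=
  {ω | (G.run ω).val.nodes = Finset.univ ∧ (G.run ω).val.edges = G.edges ∧
    ((G.run ω).cost : ℝ) ≤ B}

end

/-- The probability of an event. -/
noncomputable def prob {Ω : Type} (p : PMF Ω) (A : Set Ω) : ℝ := (p.toOuterMeasure A).toReal

end FindTopo

/-!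
FIND-TOPO can go wrong in two ways: it can accept an edge that does not exist, or it can stop before
it has found all edges.

*Stopping early.* For generic coefficients the impulse response vectors of the network are pairwise
independent (`Network.Generic.independent`): an internal node has two outgoing edges, so the vector
of an edge into it is a random combination of two independent vectors and hits the line of another
edge with probability `1 / q`. If in addition the candidate set is complete, then a round that finds
nothing ends with the whole network (`Network.Sound.complete`): for a missing edge of least depth,
everything downstream of its head has been found, so the vectors out of the head are right and have
rank greater than one, and the test of the edge would have succeeded.

*False edges.* The coefficients of an edge that does not exist are uniform even when the
coefficients of the network, the messages and the errors are given. The difficulty is that the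
graph at the time of a test is chosen adaptively. But as long as no false edge has been accepted,
the run depends only on the given data, because the tests of false edges have failed and the other
tests involve only coefficients of the network. So for given data there is one sequence of states
(`Network.Leads`) through at most `|E| + 1` different graphs, and a union bound over these graphs,
the pairs of nodes and the candidate lines is enough (`Network.card_not_safe`). For each pair of
nodes only one parallel edge can be a false candidate, namely the first one that the network does not
have. The bound for given data passes to the joint law by `Network.prob_le_of_used`.

The cost is bounded along the same sequence of states. Each node `u` causes at most one failed test
at each node `v` in each round, every round but the last makes a discovery, and there are at most
`|E|` discoveries.
-/

namespace FindTopo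

/-! ### Computations that count operations -/

@[simp] theorem Ops.pure_val {α : Type} (a : α) : (pure a : Ops α).val = a := rfl
@[simp] theorem Ops.pure_cost {α : Type} (a : α) : (pure a : Ops α).cost = 0 := rfl
@[simp] theorem Ops.bind_val {α β : Type} (x : Ops α) (f : α → Ops β) :
    (x >>= f).val = (f x.val).val := rfl
@[simp] theorem Ops.bind_cost {α β : Type} (x : Ops α) (f : α → Ops β) :
    (x >>= f).cost = x.cost + (f x.val).cost := rfl

theorem Ops.ext' {α : Type} {x y : Ops α} (h₁ : x.val = y.val) (h₂ : x.cost = y.cost) : x = y := by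
  cases x; cases y; simp_all

instance : LawfulMonad Ops := LawfulMonad.mk'
  (id_map := fun x => Ops.ext' rfl rfl)
  (pure_bind := fun _ _ => Ops.ext' rfl (Nat.zero_add _))
  (bind_assoc := fun _ _ _ => Ops.ext' rfl (Nat.add_assoc _ _ _))

/-- A search is successful exactly when some element of the list passes the test. -/
theorem anyM_val {α : Type} (p : α → Ops Bool) (l : List α) :
    (l.anyM p).val = true ↔ ∃ a ∈ l, (p a).val = true := by
  induction l with
  | nil => simp [List.anyM]
  | cons a l ih =>
    simp only [List.anyM, Ops.bind_val, List.mem_cons, exists_eq_or_imp, ← ih]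
    cases h : (p a).val <;> simp

theorem anyM_cost_le {α : Type} (p : α → Ops Bool) (l : List α) (c : ℕ)
    (h : ∀ a ∈ l, (p a).cost ≤ c) : (l.anyM p).cost ≤ l.length * c := by
  induction l with
  | nil => simp [List.anyM]
  | cons a l ih =>
    have h1 := h a (by simp)
    have h2 := ih fun b hb => h b (by simp [hb])
    simp only [List.anyM, Ops.bind_cost, List.length_cons]
    cases h : (p a).val
    · simp only
      nlinarith
    · simp only [Ops.pure_cost]
      nlinarith

theorem foldlM_cost_le {σ α : Type} (f : σ → α → Ops σ) (l : List α) (c : ℕ)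
    (h : ∀ s, ∀ a ∈ l, (f s a).cost ≤ c) (s : σ) : (l.foldlM f s).cost ≤ l.length * c := by
  induction l generalizing s with
  | nil => simp
  | cons a l ih =>
    have h1 := h s a (by simp)
    have h2 := ih (fun s b hb => h s b (by simp [hb])) (f s a).val
    simp only [List.foldlM_cons, Ops.bind_cost, List.length_cons]
    nlinarith

/-- A fold whose steps agree on the elements of the list gives the same result. -/
theorem foldlM_congr_mem {σ α : Type} {f g : σ → α → Ops σ} {l : List α}
    (h : ∀ s, ∀ a ∈ l, f s a = g s a) (s : σ) : l.foldlM f s = l.foldlM g s := by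
  induction l generalizing s with
  | nil => rfl
  | cons a l ih =>
    rw [List.foldlM_cons, List.foldlM_cons, h s a (by simp)]
    congr 1
    funext s'
    exact ih (fun s b hb => h s b (by simp [hb])) s'

/-! ### Linear dependence tests -/

section
variable {C : ℕ} {F : Type} [Field F]

theorem span_generator {L : Submodule F (Fin C → F)} (hL : Module.finrank F L = 1) :
    generator L ≠ 0 ∧ Submodule.span F {generator L} = L := by
  have h : ∃ x, Submodule.span F {x} = L := by
    obtain ⟨v, hv⟩ := (Submodule.finrank_le_one_iff_isPrincipal L).1 hL.le
    exact ⟨v, hv.symm⟩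
  have h1 : Submodule.span F {generator L} = L := by
    rw [generator, dif_pos h]; exact h.choose_spec
  refine ⟨fun h0 => ?_, h1⟩
  rw [h0, Submodule.span_zero_singleton] at h1
  rw [← h1, finrank_bot] at hL
  exact zero_ne_one hL

theorem length_encode (S : Finset (Submodule F (Fin C → F))) : (encode S).length = S.card := by
  simp [encode]

variable [DecidableEq F]

theorem pivot_none {x : Fin C → F} : (pivot x).val = none ↔ x = 0 := by
  simp [pivot, List.find?_eq_none, funext_iff]

theorem pivot_some {x : Fin C → F} {j : Fin C} (h : (pivot x).val = some j) : x j ≠ 0 := by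
  simpa using List.find?_some h

theorem dependent_val (h x : Fin C → F) :
    (dependent h x).val = true ↔ h = 0 ∨ x ∈ Submodule.span F {h} := by
  unfold dependent
  rw [Ops.bind_val]
  cases hp : (pivot h).val with
  | none => simp [pivot_none.1 hp]
  | some j =>
    have hj := pivot_some hp
    have h0 : h ≠ 0 := by rintro rfl; simp at hj
    simp only [Ops.bind_val, vsmul, veq, decide_eq_true_eq, h0, false_or,
      Submodule.mem_span_singleton]
    constructor
    · intro e
      refine ⟨(h j)⁻¹ * x j, ?_⟩
      rw [mul_smul, ← e, smul_smul, inv_mul_cancel₀ hj, one_smul]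
    · rintro ⟨a, rfl⟩
      simp only [Pi.smul_apply, smul_eq_mul, smul_smul]
      rw [mul_comm]

theorem dependent_cost_le (h x : Fin C → F) : (dependent h x).cost ≤ 4 * C := by
  unfold dependent
  rw [Ops.bind_cost]
  have : (pivot h).cost = C := rfl
  cases hp : (pivot h).val with
  | none => simp; omega
  | some j => simp [vsmul, veq]; omega

/-- The rank test finds a nonzero vector and a vector outside the line that it spans. -/
theorem rankGtOne_val (l : List (Fin C → F)) :
    (rankGtOne l).val = true ↔ ∃ h ∈ l, ∃ x ∈ l, h ≠ 0 ∧ x ∉ Submodule.span F {h} := by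
  simp only [rankGtOne, anyM_val, Ops.bind_val, Ops.pure_val, Bool.not_eq_true',
    ← Bool.not_eq_true, dependent_val, not_or]

theorem rankGtOne_cost_le (l : List (Fin C → F)) :
    (rankGtOne l).cost ≤ l.length * (l.length * (4 * C)) := by
  refine anyM_cost_le _ _ _ fun h _ => anyM_cost_le _ _ _ fun x _ => ?_
  rw [Ops.bind_cost]
  exact dependent_cost_le h x

theorem inCands_val (cands : List (Fin C → F)) (x : Fin C → F) :
    (inCands cands x).val = true ↔
      x ≠ 0 ∧ ∃ h ∈ cands, h = 0 ∨ x ∈ Submodule.span F {h} := by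
  simp only [inCands, anyM_val, Ops.bind_val]
  cases hp : (pivot x).val with
  | none => simp [pivot_none.1 hp]
  | some j =>
    have hj := pivot_some hp
    have h0 : x ≠ 0 := by rintro rfl; simp at hj
    simp [dependent_val, h0]

theorem inCands_cost_le (cands : List (Fin C → F)) (x : Fin C → F) :
    (inCands cands x).cost ≤ cands.length * (5 * C) := by
  refine anyM_cost_le _ _ _ fun h _ => ?_
  rw [Ops.bind_cost]
  have h1 : (pivot x).cost = C := rfl
  have h2 := dependent_cost_le h x
  cases (pivot x).val with
  | none => simp; omega
  | some j => simp only; omega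

/-- On a list that encodes a set of lines, the membership test accepts exactly the nonzero vectors
that lie on one of the lines. -/
theorem inCands_encode {S : Finset (Submodule F (Fin C → F))}
    (hS : ∀ L ∈ S, Module.finrank F L = 1) (x : Fin C → F) :
    (inCands (encode S) x).val = true ↔ x ≠ 0 ∧ ∃ L ∈ S, x ∈ L := by
  rw [inCands_val]
  refine and_congr_right fun _ => ?_
  simp only [encode, List.mem_map, Finset.mem_toList, exists_exists_and_eq_and]
  refine exists_congr fun L => and_congr_right fun hL => ?_
  obtain ⟨h0, h1⟩ := span_generator (hS L hL)
  rw [h1]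
  simp [h0]

end

/-! ### Edge lists and the computation of impulse response vectors -/

section
variable {N m C : ℕ} {F : Type}

theorem mem_edgeList {E : Finset (Edge N m)} {e : Edge N m} : e ∈ edgeList E ↔ e ∈ E := by
  obtain ⟨u, v, i⟩ := e
  simp [edgeList]

theorem nodup_edgeList (E : Finset (Edge N m)) : (edgeList E).Nodup := by
  refine List.Nodup.filter _ ?_
  have h : ((List.finRange N).flatMap fun u => (List.finRange N).flatMap fun v =>
      (List.finRange m).map fun i => (u, v, i)) =
      (List.finRange N).product ((List.finRange N).product (List.finRange m)) := by
    simp [List.product, List.map_flatMap, Function.comp_def]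
  rw [h]
  exact (List.nodup_finRange N).product ((List.nodup_finRange N).product (List.nodup_finRange m))

theorem length_edgeList (E : Finset (Edge N m)) : (edgeList E).length = E.card := by
  rw [← List.toFinset_card_of_nodup (nodup_edgeList E)]
  congr 1
  ext e
  simp [mem_edgeList]

theorem mem_outEdges {E : Finset (Edge N m)} {v : Fin N} {e : Edge N m} :
    e ∈ outEdges E v ↔ e ∈ E ∧ e.src = v := by
  simp [outEdges, mem_edgeList]

theorem length_outEdges_le (E : Finset (Edge N m)) (v : Fin N) :
    (outEdges E v).length ≤ E.card :=
  (List.length_filter_le _ _).trans (length_edgeList E).le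

variable [Field F]

theorem combine_val (R : Codebook N m F) (f : Edge N m → Fin C → F) (e : Edge N m)
    (l : List (Edge N m)) :
    (combine R f e l).val = (l.map fun e' => coef R e e' • f e').sum := by
  suffices h : ∀ x, (l.foldlM (fun acc e' => do
      let y ← vsmul (coef R e e') (f e')
      vadd acc y) x : Ops (Fin C → F)).val = x + (l.map fun e' => coef R e e' • f e').sum by
    exact (h 0).trans (zero_add _)
  intro x
  induction l generalizing x with
  | nil => simp
  | cons a l ih =>
    rw [List.foldlM_cons, Ops.bind_val, ih]
    simp [vsmul, vadd, add_assoc]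

theorem combine_outEdges_val (R : Codebook N m F) (f : Edge N m → Fin C → F) (e : Edge N m)
    (E : Finset (Edge N m)) :
    (combine R f e (outEdges E e.dst)).val =
      ∑ e' ∈ E.filter (fun e' => e'.src = e.dst), coef R e e' • f e' := by
  have h : E.filter (fun e' => e'.src = e.dst) = (outEdges E e.dst).toFinset := by
    ext e'
    simp [mem_outEdges]
  rw [combine_val, h, List.sum_toFinset (l := outEdges E e.dst) _ ((nodup_edgeList E).filter _)]

theorem combine_cost_le (R : Codebook N m F) (f : Edge N m → Fin C → F) (e : Edge N m)
    (E : Finset (Edge N m)) (v : Fin N) :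
    (combine R f e (outEdges E v)).cost ≤ E.card * (2 * C) := by
  refine (foldlM_cost_le _ _ (2 * C) (fun s a _ => ?_) _).trans
    (Nat.mul_le_mul_right _ (length_outEdges_le E v))
  simp [vsmul, vadd, two_mul]

theorem computeIRVs_cost_le (r : Fin N) (port : Fin C → Fin N × Fin m) (R : Codebook N m F)
    (E : Finset (Edge N m)) :
    (computeIRVs r port R E).cost ≤ N * (E.card * (E.card * (2 * C))) := by
  refine (foldlM_cost_le _ _ (E.card * (E.card * (2 * C))) (fun f _ _ => ?_) _).trans (by simp)
  refine (foldlM_cost_le _ _ (E.card * (2 * C)) (fun g e _ => ?_) _).trans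
    (by rw [length_edgeList])
  split_ifs
  · simp
  · rw [Ops.bind_cost]
    exact combine_cost_le R f e E e.dst

end

section
variable {N m C : ℕ} {F : Type} (G : Network N m C)

/-! ### Changing one coefficient -/

/-- The codebook with the coefficient from `e` to `e'` replaced by `a`. -/
def setCoef (R : Codebook N m F) (e e' : Edge N m) (a : F) : Codebook N m F := fun v x y =>
  if v = e.dst ∧ x = (e.src, e.num) ∧ y = (e'.dst, e'.num) then a else R v x y

theorem coef_setCoef_self (R : Codebook N m F) (e e' : Edge N m) (a : F) :
    coef (setCoef R e e' a) e e' = a := by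
  simp [coef, setCoef]

theorem setCoef_setCoef (R : Codebook N m F) (e e' : Edge N m) (a b : F) :
    setCoef (setCoef R e e' a) e e' b = setCoef R e e' b := by
  funext v x y
  simp only [setCoef]
  split_ifs <;> rfl

theorem setCoef_coef (R : Codebook N m F) (e e' : Edge N m) :
    setCoef R e e' (coef R e e') = R := by
  funext v x y
  simp only [setCoef, coef]
  split_ifs with h
  · rw [h.1, h.2.1, h.2.2]
  · rfl

theorem coef_setCoef_of_ne (R : Codebook N m F) {e e' f f' : Edge N m} (a : F)
    (he : e'.src = e.dst) (hf : f'.src = f.dst) (h : f ≠ e ∨ f' ≠ e') :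
    coef (setCoef R e e' a) f f' = coef R f f' := by
  refine if_neg ?_
  obtain ⟨u, v, i⟩ := e
  obtain ⟨u', v', i'⟩ := e'
  obtain ⟨x, y, j⟩ := f
  obtain ⟨x', y', j'⟩ := f'
  simp only [Edge.src, Edge.dst, Edge.num, Prod.mk.injEq, ne_eq] at *
  rintro ⟨rfl, ⟨rfl, rfl⟩, rfl, rfl⟩
  simp_all

/-! ### Acyclic networks -/

/-- The number of nodes that can be reached from `v` along at least one edge. It decreases along
every edge and so serves as the depth for inductions from the receiver upwards. -/
noncomputable def Network.depth (v : Fin N) : ℕ :=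
  Set.ncard {w | Relation.TransGen (Adj G.edges) v w}

theorem Network.depth_lt_card (v : Fin N) : G.depth v < N := by
  have h : {w | Relation.TransGen (Adj G.edges) v w} ⊂ Set.univ :=
    Set.ssubset_univ_iff.2 fun h => G.acyclic v (h.symm ▸ Set.mem_univ v :
      v ∈ {w | Relation.TransGen (Adj G.edges) v w})
  simpa [Network.depth] using Set.ncard_lt_ncard h

theorem Network.depth_lt {e : Edge N m} (he : e ∈ G.edges) : G.depth e.dst < G.depth e.src := by
  have ha : Adj G.edges e.src e.dst := ⟨e.num, he⟩
  refine Set.ncard_lt_ncard (Set.ssubset_iff_of_subset ?_ |>.2 ⟨e.dst, .single ha, G.acyclic _⟩)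
  exact fun w hw => .head ha hw

theorem Network.src_ne_dst {e : Edge N m} (he : e ∈ G.edges) : e.src ≠ e.dst := by
  intro h
  have := G.depth_lt he
  rw [h] at this
  exact lt_irrefl _ this

theorem Network.exists_out {v : Fin N} (hv : v ≠ G.r) : ∃ e ∈ G.edges, e.src = v := by
  rcases Relation.ReflTransGen.cases_head (G.reach v) with h | ⟨w, ⟨i, hi⟩, -⟩
  · exact absurd h hv
  · exact ⟨_, hi, rfl⟩

theorem Network.depth_r : G.depth G.r = 0 := by
  have h : {w | Relation.TransGen (Adj G.edges) G.r w} = ∅ := by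
    ext w
    simp only [Set.mem_ofPred_eq, Set.mem_empty_iff_false, iff_false]
    exact fun h => G.acyclic _ (h.trans_left (G.reach w))
  rw [Network.depth, h, Set.ncard_empty]

theorem Network.eq_r_of_depth_le {v : Fin N} (h : G.depth v ≤ 0) : v = G.r := by
  by_contra hv
  obtain ⟨e, he, rfl⟩ := G.exists_out hv
  have := G.depth_lt he
  omega

theorem Network.dst_ne_s {e : Edge N m} (he : e ∈ G.edges) : e.dst ≠ G.s := by
  intro h
  obtain ⟨u, v, i⟩ := e
  cases h
  exact G.source_no_in u i he

/-- Every node other than the source and the receiver has two outgoing edges. -/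
theorem Network.exists_two_out {v : Fin N} (hs : v ≠ G.s) (hr : v ≠ G.r) :
    ∃ e₁ ∈ G.edges, ∃ e₂ ∈ G.edges, e₁.src = v ∧ e₂.src = v ∧ e₁ ≠ e₂ ∧
      G.depth e₂.dst ≤ G.depth e₁.dst := by
  obtain ⟨a, ha, b, hb, hab⟩ := Finset.one_lt_card.1 (G.weakly_connected v hs hr)
  rw [Finset.mem_filter] at ha hb
  rcases le_total (G.depth b.dst) (G.depth a.dst) with h | h
  · exact ⟨a, ha.1, b, hb.1, ha.2, hb.2, hab, h⟩
  · exact ⟨b, hb.1, a, ha.1, hb.2, ha.2, hab.symm, h⟩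

/-- Every node but the receiver is the tail of an edge. -/
theorem Network.nodes_le : N ≤ G.edges.card + 1 := by
  have h : (Finset.univ : Finset (Fin N)) ⊆ insert G.r (G.edges.image Edge.src) := by
    intro v _
    by_cases hv : v = G.r
    · simp [hv]
    · obtain ⟨e, he, rfl⟩ := G.exists_out hv
      simp only [Finset.mem_insert, Finset.mem_image]
      exact .inr ⟨e, he, rfl⟩
  have h1 := Finset.card_le_card h
  rw [Finset.card_univ, Fintype.card_fin] at h1
  exact h1.trans ((Finset.card_insert_le _ _).trans
    (Nat.add_le_add_right Finset.card_image_le 1))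

theorem Network.one_le_nodes {N m C : ℕ} (G : Network N m C) : 1 ≤ N := Fin.pos G.r

theorem Network.one_le_edges : 1 ≤ G.edges.card := by
  obtain ⟨e, he, -⟩ := G.exists_out G.s_ne_r
  exact Finset.card_pos.2 ⟨e, he⟩

/-! ### The recursion for impulse response vectors -/

variable [Field F]

/-- A value of the recursion depends only on the edges downstream and on their coefficients, and
the cut-off is irrelevant once it exceeds the depth of the head. -/
theorem Network.irvAux_congr {E E' : Finset (Edge N m)} (hE : E ⊆ G.edges)
    {R R' : Codebook N m F} {k k' : ℕ} {e : Edge N m} (hk : G.depth e.dst < k)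
    (hk' : G.depth e.dst < k')
    (hEE : ∀ f, G.depth f.src ≤ G.depth e.dst → (f ∈ E ↔ f ∈ E'))
    (hR : ∀ f f', (f = e ∨ f ∈ E ∧ G.depth f.dst < G.depth e.dst) → f' ∈ E →
      f'.src = f.dst → coef R f f' = coef R' f f') :
    irvAux G.r G.port E R k e = irvAux G.r G.port E' R' k' e := by
  induction k generalizing k' e with
  | zero => omega
  | succ k ih =>
    obtain ⟨k', rfl⟩ : ∃ j, k' = j + 1 := ⟨k' - 1, by omega⟩
    rw [irvAux, irvAux]
    split_ifs with hr
    · rfl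
    have hf : E.filter (fun e' => e'.src = e.dst) = E'.filter (fun e' => e'.src = e.dst) := by
      ext f
      simp only [Finset.mem_filter]
      exact and_congr_left fun h => hEE f (by rw [h])
    rw [← hf]
    refine Finset.sum_congr rfl fun f hf => ?_
    rw [Finset.mem_filter] at hf
    have hd : G.depth f.dst < G.depth e.dst := hf.2 ▸ G.depth_lt (hE hf.1)
    rw [hR e f (.inl rfl) hf.1 hf.2]
    congr 1
    refine ih (by omega) (by omega) (fun g hg => hEE g (by omega)) fun g g' hg hg' hgg => ?_
    refine hR g g' (.inr ?_) hg' hgg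
    rcases hg with rfl | ⟨h1, h2⟩
    · exact ⟨hf.1, hd⟩
    · exact ⟨h1, h2.trans hd⟩

theorem Network.irvAux_of_dst_eq {E : Finset (Edge N m)} {R : Codebook N m F} {e : Edge N m}
    (h : e.dst = G.r) : irvAux G.r G.port E R N e = unitVec G.port e := by
  obtain ⟨k, hk⟩ : ∃ k, N = k + 1 := ⟨N - 1, by have := G.one_le_nodes; omega⟩
  have : ∀ n, n = k + 1 → irvAux G.r G.port E R n e = unitVec G.port e := by
    rintro n rfl
    rw [irvAux, if_pos h]
  exact this N hk

/-- The cut-off at `N` edges leaves the recursion intact on every subgraph of the network. -/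
theorem Network.irvAux_eq_sum {E : Finset (Edge N m)} (hE : E ⊆ G.edges) {R : Codebook N m F}
    {e : Edge N m} (h : e.dst ≠ G.r) :
    irvAux G.r G.port E R N e =
      ∑ e' ∈ E.filter (fun e' => e'.src = e.dst), coef R e e' • irvAux G.r G.port E R N e' := by
  have hd := G.depth_lt_card e.dst
  rw [G.irvAux_congr hE (R' := R) hd (hd.trans (Nat.lt_succ_self N)) (fun _ _ => Iff.rfl)
    fun _ _ _ _ _ => rfl, irvAux, if_neg h]

theorem Network.irv_of_dst_eq {R : Codebook N m F} {e : Edge N m} (h : e.dst = G.r) :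
    G.irv R e = unitVec G.port e := G.irvAux_of_dst_eq h

theorem Network.irv_eq_sum {R : Codebook N m F} {e : Edge N m} (h : e.dst ≠ G.r) :
    G.irv R e = ∑ e' ∈ G.edges.filter (fun e' => e'.src = e.dst), coef R e e' • G.irv R e' :=
  G.irvAux_eq_sum Finset.Subset.rfl h

theorem Network.coef_used {R : Codebook N m F} {e e' : Edge N m} (he : e ∈ G.edges)
    (he' : e' ∈ G.edges) (h : e'.src = e.dst) : coef (G.used R) e e' = coef R e e' := by
  obtain ⟨u, v, i⟩ := e
  obtain ⟨v', w, j⟩ := e'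
  cases h
  exact if_pos ⟨he, he'⟩

/-- The vectors of the network do not depend on the entries that the network does not use. -/
theorem Network.irv_used {R : Codebook N m F} {e : Edge N m} (he : e ∈ G.edges) :
    G.irv (G.used R) e = G.irv R e := by
  have hd := G.depth_lt_card e.dst
  refine G.irvAux_congr Finset.Subset.rfl hd hd (fun _ _ => Iff.rfl) fun f f' hf hf' h => ?_
  refine G.coef_used ?_ hf' h
  rcases hf with rfl | hf
  exacts [he, hf.1]

/-- A sweep makes the values right for one more layer of edges. The edges into the receiver, which
no sweep changes, are right from the start. -/
theorem Network.sweep_val {E : Finset (Edge N m)} (hE : E ⊆ G.edges) {R : Codebook N m F}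
    {f : Edge N m → Fin C → F} {n : ℕ}
    (hf : ∀ e ∈ E, e.dst = G.r ∨ G.depth e.dst < n → f e = irvAux G.r G.port E R N e) :
    ∀ e ∈ E, e.dst = G.r ∨ G.depth e.dst < n + 1 →
      (sweep G.r R E f).val e = irvAux G.r G.port E R N e := by
  suffices h : ∀ (l : List (Edge N m)) (g : Edge N m → Fin C → F) (P : Edge N m → Prop),
      (∀ e ∈ E, (e.dst = G.r ∨ G.depth e.dst < n ∨ P e ∧ G.depth e.dst < n + 1) →
        g e = irvAux G.r G.port E R N e) →
      ∀ e ∈ E, (e.dst = G.r ∨ G.depth e.dst < n ∨ (P e ∨ e ∈ l) ∧ G.depth e.dst < n + 1) →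
        (l.foldlM (fun g e => if e.dst = G.r then pure g else do
          let x ← combine R f e (outEdges E e.dst)
          pure (Function.update g e x)) g : Ops _).val e = irvAux G.r G.port E R N e by
    refine fun e he hd => h _ f (fun _ => False) (fun e he hd => hf e he ?_) e he ?_
    · simpa using hd
    · rcases hd with hd | hd
      exacts [.inl hd, .inr (.inr ⟨.inr (mem_edgeList.2 he), hd⟩)]
  -- `P` marks the edges that the sweep has already treated.
  intro l
  induction l with
  | nil => simp
  | cons a l ih =>
    intro g P hP e he hd
    rw [List.foldlM_cons, Ops.bind_val]
    refine ih _ (fun e => P e ∨ e = a) (fun e he hd => ?_) e he ?_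
    · by_cases ha : a.dst = G.r
      · rw [if_pos ha]
        refine hP e he ?_
        rcases hd with hd | hd | ⟨hd | rfl, hd'⟩
        exacts [.inl hd, .inr (.inl hd), .inr (.inr ⟨hd, hd'⟩), .inl ha]
      rw [if_neg ha, Ops.bind_val, Ops.pure_val, combine_outEdges_val]
      by_cases hea : e = a
      · subst hea
        rw [Function.update_self, G.irvAux_eq_sum hE ha]
        refine Finset.sum_congr rfl fun e' he' => ?_
        rw [Finset.mem_filter] at he'
        have h1 := G.depth_lt (hE he'.1)
        rw [he'.2] at h1
        have h2 : G.depth e.dst < n + 1 := by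
          rcases hd with hd | hd | hd
          exacts [absurd hd ha, by omega, hd.2]
        rw [hf e' he'.1 (.inr (by omega))]
      · rw [Function.update_of_ne hea]
        refine hP e he ?_
        simpa [hea] using hd
    · simpa [or_assoc] using hd

/-- On a subgraph of the network the sweeps compute the solution of the recursion. -/
theorem Network.computeIRVs_val {E : Finset (Edge N m)} (hE : E ⊆ G.edges) (R : Codebook N m F)
    {e : Edge N m} (he : e ∈ E) :
    (computeIRVs G.r G.port R E).val e = irvAux G.r G.port E R N e := by
  suffices h : ∀ (l : List ℕ) (f : Edge N m → Fin C → F) (n : ℕ),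
      (∀ e ∈ E, e.dst = G.r ∨ G.depth e.dst < n → f e = irvAux G.r G.port E R N e) →
      ∀ e ∈ E, e.dst = G.r ∨ G.depth e.dst < n + l.length →
        (l.foldlM (fun f _ => sweep G.r R E f) f : Ops _).val e = irvAux G.r G.port E R N e by
    refine h _ _ 0 (fun e _ hd => ?_) e he (.inr (by simpa using G.depth_lt_card e.dst))
    have hd : e.dst = G.r := by simpa using hd
    rw [G.irvAux_of_dst_eq hd, initIRV, if_pos hd]
  intro l
  induction l with
  | nil => simp
  | cons a l ih =>
    intro f n hf e he hd
    rw [List.foldlM_cons, Ops.bind_val]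
    refine ih _ (n + 1) (G.sweep_val hE hf) e he ?_
    rw [List.length_cons] at hd
    rcases hd with hd | hd
    exacts [.inl hd, .inr (by omega)]

/-! ### Pairwise independence of the impulse response vectors -/

theorem Network.used_setCoef (R : Codebook N m F) {e : Edge N m} (he : e ∉ G.edges)
    (e' : Edge N m) (a : F) : G.used (setCoef R e e' a) = G.used R := by
  funext v x y
  simp only [Network.used]
  split_ifs with h
  · refine if_neg ?_
    rintro ⟨rfl, rfl, rfl⟩
    exact he h.1
  · rfl

/-- If a combination of vectors lies in a subspace that misses the vector at `e₀`, then the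
coefficient of `e₀` cannot be changed without leaving the subspace. -/
theorem eq_coef_of_sum_mem {L : Submodule F (Fin C → F)} {R : Codebook N m F} {e e₀ : Edge N m}
    {s : Finset (Edge N m)} (hs : ∀ e' ∈ s, e'.src = e.dst) (h₀ : e₀ ∈ s)
    {f : Edge N m → Fin C → F} (hf : f e₀ ∉ L) {a : F}
    (h₁ : ∑ e' ∈ s, coef R e e' • f e' ∈ L)
    (h₂ : ∑ e' ∈ s, coef (setCoef R e e₀ a) e e' • f e' ∈ L) : a = coef R e e₀ := by
  have h := L.sub_mem h₂ h₁
  rw [← Finset.sum_sub_distrib, Finset.sum_eq_single_of_mem e₀ h₀, coef_setCoef_self,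
    ← sub_smul] at h
  · by_contra hne
    exact hf ((L.smul_mem_iff (sub_ne_zero.2 hne)).1 h)
  · intro e' he' hne
    rw [coef_setCoef_of_ne R a (hs _ h₀) (hs _ he') (.inr hne), sub_self]

/-- Changing a coefficient of `e` does not affect the other edges of at most the same depth. -/
theorem Network.irv_setCoef (R : Codebook N m F) {e e' f : Edge N m} (he : e'.src = e.dst)
    (hf : f ≠ e) (hd : G.depth f.dst ≤ G.depth e.dst) (a : F) :
    G.irv (setCoef R e e' a) f = G.irv R f := by
  have h := G.depth_lt_card f.dst
  refine G.irvAux_congr Finset.Subset.rfl h h (fun _ _ => Iff.rfl) fun g g' hg hg' hgg => ?_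
  refine coef_setCoef_of_ne R a he hgg (.inl ?_)
  rintro rfl
  rcases hg with rfl | hg
  · exact hf rfl
  · omega

/-- No edge has its impulse response vector, by an accident of its coefficients, on the line of
another edge of at most the same depth. -/
def Network.Generic (R : Codebook N m F) : Prop :=
  ∀ e ∈ G.edges, e.dst ≠ G.r → ∀ e' ∈ G.edges, e'.src = e.dst →
    ∀ e'' ∈ G.edges, e'' ≠ e → G.depth e''.dst ≤ G.depth e.dst →
      G.irv R e' ∉ Submodule.span F {G.irv R e''} → G.irv R e ∉ Submodule.span F {G.irv R e''}

/-- If two vectors are independent, then every line misses one of them. -/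
theorem not_mem_span_or {V : Type*} [AddCommGroup V] [Module F V] {x₁ x₂ y : V} (h₂ : x₂ ≠ 0)
    (h : x₁ ∉ Submodule.span F {x₂}) :
    x₁ ∉ Submodule.span F {y} ∨ x₂ ∉ Submodule.span F {y} := by
  by_contra! hc
  simp only [Submodule.mem_span_singleton] at h hc
  obtain ⟨⟨a, rfl⟩, b, rfl⟩ := hc
  have hb : b ≠ 0 := by rintro rfl; simp at h₂
  exact h ⟨a * b⁻¹, by rw [smul_smul, mul_assoc, inv_mul_cancel₀ hb, mul_one]⟩

/-- For generic coefficients the impulse response vectors are pairwise independent: every internal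
node has two outgoing edges, so independence propagates from the receiver upwards. -/
theorem Network.Generic.independent {G : Network N m C} {R : Codebook N m F} (hR : G.Generic R)
    {e : Edge N m} (he : e ∈ G.edges) :
    G.irv R e ≠ 0 ∧ ∀ e'' ∈ G.edges, e'' ≠ e → G.depth e''.dst ≤ G.depth e.dst →
      G.irv R e ∉ Submodule.span F {G.irv R e''} := by
  induction hn : G.depth e.dst using Nat.strong_induction_on generalizing e with
  | _ n ih =>
  subst hn
  by_cases hr : e.dst = G.r
  · have hport : ∀ f ∈ G.edges, f.dst = G.r → ∃ j, G.port j = (f.src, f.num) := by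
      rintro ⟨u, v, i⟩ hf rfl
      exact (G.mem_port u i).1 hf
    obtain ⟨j, hj⟩ := hport e he hr
    have hej : G.irv R e j = 1 := by rw [G.irv_of_dst_eq hr, unitVec, if_pos hj]
    refine ⟨fun h0 => by simp [h0] at hej, fun e'' he'' hne hd hmem => ?_⟩
    rw [hr, G.depth_r] at hd
    have hr'' := G.eq_r_of_depth_le hd
    obtain ⟨a, ha⟩ := Submodule.mem_span_singleton.1 hmem
    have h0 : G.irv R e'' j = 0 := by
      rw [G.irv_of_dst_eq hr'', unitVec, if_neg]
      rw [hj]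
      obtain ⟨u, v, i⟩ := e
      obtain ⟨u', v', i'⟩ := e''
      simp only [Edge.src, Edge.dst, Edge.num, Prod.mk.injEq, ne_eq, not_and] at *
      rintro rfl rfl
      simp_all
    rw [← ha] at hej
    simp [h0] at hej
  · obtain ⟨e₁, he₁, e₂, he₂, hs₁, hs₂, hne, hd⟩ := G.exists_two_out (G.dst_ne_s he) hr
    have hd₁ := G.depth_lt he₁
    have hd₂ := G.depth_lt he₂
    rw [hs₁] at hd₁
    rw [hs₂] at hd₂
    have h₁ := (ih _ hd₁ he₁ rfl).2 e₂ he₂ hne.symm hd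
    have h₂ := (ih _ hd₂ he₂ rfl).1
    have key : ∀ e'' ∈ G.edges, e'' ≠ e → G.depth e''.dst ≤ G.depth e.dst →
        G.irv R e ∉ Submodule.span F {G.irv R e''} := by
      intro e'' he'' hne'' hd''
      rcases not_mem_span_or (y := G.irv R e'') h₂ h₁ with h | h
      · exact hR e he hr e₁ he₁ hs₁ e'' he'' hne'' hd'' h
      · exact hR e he hr e₂ he₂ hs₂ e'' he'' hne'' hd'' h
    refine ⟨fun h0 => key e₁ he₁ ?_ hd₁.le (h0 ▸ Submodule.zero_mem _), key⟩
    rintro rfl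
    exact lt_irrefl _ hd₁

end

/-! ### Runs that make no false discovery -/

section
variable {N m C : ℕ} {F : Type} [Field F] (G : Network N m C)

/-- The state of FIND-TOPO describes a subgraph of the network that contains the edges into the
receiver, with the right nodes and the vectors of that subgraph. `U` is a codebook with the
coefficients that the network uses. -/
structure Network.Sound (U : Codebook N m F) (st : State N m C F) : Prop where
  sub : st.edges ⊆ G.edges
  init : ∀ e ∈ G.edges, e.dst = G.r → e ∈ st.edges
  nodes : ∀ v, v ∈ st.nodes ↔ v = G.r ∨ v = G.s ∨ ∃ e ∈ st.edges, e.src = v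
  irvs : ∀ e ∈ st.edges, st.irvs e = irvAux G.r G.port st.edges U N e

theorem Network.sound_initState (U : Codebook N m F) :
    G.Sound U (initState G.s G.r G.port : State N m C F) := by
  have hmem : ∀ e : Edge N m, e ∈ (initState G.s G.r G.port : State N m C F).edges ↔
      e ∈ G.edges ∧ e.dst = G.r := by
    rintro ⟨u, v, i⟩
    simp only [initState, Finset.mem_image, Finset.mem_univ, true_and, Prod.mk.injEq, Edge.dst]
    constructor
    · rintro ⟨j, rfl, rfl, rfl⟩
      exact ⟨(G.mem_port _ _).2 ⟨j, rfl⟩, rfl⟩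
    · rintro ⟨h, rfl⟩
      obtain ⟨j, hj⟩ := (G.mem_port _ _).1 h
      exact ⟨j, by rw [hj], rfl, by rw [hj]⟩
  refine ⟨fun e he => ((hmem e).1 he).1, fun e he hr => (hmem e).2 ⟨he, hr⟩, fun v => ?_,
    fun e he => ?_⟩
  · simp [initState, Edge.src]
  · have hr := ((hmem e).1 he).2
    rw [G.irvAux_of_dst_eq hr]
    exact if_pos hr

variable {G}

theorem Network.coef_eq_of_used {U R : Codebook N m F} (hU : G.used R = U) {e e' : Edge N m}
    (he : e ∈ G.edges) (he' : e' ∈ G.edges) (h : e'.src = e.dst) : coef R e e' = coef U e e' := by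
  rw [← hU, G.coef_used he he' h]

/-- The computed vectors depend only on the coefficients that the network uses. -/
theorem Network.computeIRVs_congr {U R : Codebook N m F} (hU : G.used R = U)
    {E : Finset (Edge N m)} (hE : E ⊆ G.edges) :
    computeIRVs G.r G.port R E = computeIRVs G.r G.port U E := by
  refine foldlM_congr_mem (fun f _ _ => foldlM_congr_mem (fun g e he => ?_) f) _
  have h : combine R f e (outEdges E e.dst) = combine U f e (outEdges E e.dst) := by
    refine foldlM_congr_mem (fun x e' he' => ?_) 0
    rw [mem_edgeList] at he
    rw [mem_outEdges] at he'
    rw [Network.coef_eq_of_used hU (hE he) (hE he'.1) he'.2]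
  rw [h]

theorem Network.sound_insert {U : Codebook N m F} {st : State N m C F} (hst : G.Sound U st)
    {e : Edge N m} (he : e ∈ G.edges) :
    G.Sound U ⟨insert e.src st.nodes, insert e st.edges,
      (computeIRVs G.r G.port U (insert e st.edges)).val, true⟩ := by
  have hE := Finset.insert_subset he hst.sub
  refine ⟨hE, fun f hf hr => Finset.mem_insert_of_mem (hst.init f hf hr), fun v => ?_,
    fun f hf => G.computeIRVs_val hE U hf⟩
  simp only [Finset.mem_insert, hst.nodes, exists_eq_or_imp, eq_comm (a := v)]
  tauto

variable (G) [DecidableEq F]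

/-- The vectors on the edges out of `v`, computed in the graph `E`, have rank greater than one. -/
def Network.Big (U : Codebook N m F) (E : Finset (Edge N m)) (v : Fin N) : Prop :=
  (rankGtOne ((outEdges E v).map (irvAux G.r G.port E U N))).val = true

/-- In the graph `E`, the membership test rejects all candidates that are not edges of the network.
A parallel edge is a candidate only after its predecessors, so that it suffices to require this of
the first one that the network does not have. Apart from the coefficients of the tested edge, the
test depends only on coefficients that the network uses. -/
def Network.SafeAt (cands : List (Fin C → F)) (R : Codebook N m F) (E : Finset (Edge N m)) :
    Prop :=
  ∀ e ∉ G.edges, (∀ j < e.num, (e.src, e.dst, j) ∈ G.edges) → G.Big (G.used R) E e.dst →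
    (inCands cands (∑ e' ∈ E.filter (fun e' => e'.src = e.dst),
      coef R e e' • irvAux G.r G.port E (G.used R) N e')).val = false

variable (U : Codebook N m F) (cands : List (Fin C → F)) (D : ℕ)

/-- A computation `f`, which may read the whole codebook, leads from the state `st` to the state
`st'` for all codebooks that use the coefficients of `U` and make no false discovery at one of the
graphs that are passed on the way. These graphs are `st.edges` and the elements of `T`. Its cost is
at most `c`, and `D` more for every edge found. The state `st'` does not depend on the codebook, and
every element of `T` accounts for a discovery. -/
structure Network.Leads (c : ℕ) (f : Codebook N m F → Ops (State N m C F))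
    (st st' : State N m C F) (T : Finset (Finset (Edge N m))) : Prop where
  sound : G.Sound U st'
  card : T.card + st.edges.card ≤ st'.edges.card
  last : st'.edges ∈ insert st.edges T
  flag : st'.newEdge = true → st.newEdge = true ∨ st.edges.card < st'.edges.card
  run : ∀ R, G.used R = U → (∀ E ∈ insert st.edges T, G.SafeAt cands R E) →
    (f R).val = st' ∧ (f R).cost + D * st.edges.card ≤ c + D * st'.edges.card

variable {G U cands D}

theorem Network.Leads.mono {c c' : ℕ} {f : Codebook N m F → Ops (State N m C F)}
    {st st' : State N m C F} {T : Finset (Finset (Edge N m))}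
    (h : G.Leads U cands D c f st st' T) (hc : c ≤ c') : G.Leads U cands D c' f st st' T :=
  ⟨h.sound, h.card, h.last, h.flag, fun R h₁ h₂ =>
    ⟨(h.run R h₁ h₂).1, (h.run R h₁ h₂).2.trans (Nat.add_le_add_right hc _)⟩⟩

theorem Network.Leads.pure {st : State N m C F} (h : G.Sound U st) (c : ℕ) :
    G.Leads U cands D c (fun _ => Pure.pure st) st st ∅ :=
  ⟨h, by simp, by simp, .inl, fun _ _ _ => ⟨rfl, by simp⟩⟩

theorem Network.Leads.bind {c₁ c₂ : ℕ} {f : Codebook N m F → Ops (State N m C F)}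
    {g : Codebook N m F → State N m C F → Ops (State N m C F)} {st st₁ st₂ : State N m C F}
    {T₁ T₂ : Finset (Finset (Edge N m))} (h₁ : G.Leads U cands D c₁ f st st₁ T₁)
    (h₂ : G.Leads U cands D c₂ (fun R => g R st₁) st₁ st₂ T₂) :
    G.Leads U cands D (c₁ + c₂) (fun R => f R >>= g R) st st₂ (T₁ ∪ T₂) := by
  have hsub : insert st₁.edges T₂ ⊆ insert st.edges (T₁ ∪ T₂) := by
    have := h₁.last
    intro E
    simp only [Finset.mem_insert, Finset.mem_union] at *
    rintro (rfl | h)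
    · tauto
    · tauto
  refine ⟨h₂.sound, ?_, hsub h₂.last, fun h => ?_, fun R hU hR => ?_⟩
  · have := h₁.card
    have := h₂.card
    have := Finset.card_union_le T₁ T₂
    omega
  · have h1 := h₁.card
    have h2 := h₂.card
    rcases h₂.flag h with h' | h'
    · rcases h₁.flag h' with h'' | h''
      · exact .inl h''
      · exact .inr (by omega)
    · exact .inr (by omega)
  · obtain ⟨v₁, r₁⟩ := h₁.run R hU fun E hE => hR E (by
      simp only [Finset.mem_insert, Finset.mem_union] at *
      tauto)
    obtain ⟨v₂, r₂⟩ := h₂.run R hU fun E hE => hR E (hsub hE)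
    rw [Ops.bind_val, Ops.bind_cost, v₁]
    exact ⟨v₂, by omega⟩

/-- A computation that has the same result at an additional cost of at most `c₀`. -/
theorem Network.Leads.of_cost {c c₀ : ℕ} {f g : Codebook N m F → Ops (State N m C F)}
    {st st' : State N m C F} {T : Finset (Finset (Edge N m))}
    (h : G.Leads U cands D c f st st' T)
    (hg : ∀ R, G.used R = U → (g R).val = (f R).val ∧ (g R).cost ≤ c₀ + (f R).cost) :
    G.Leads U cands D (c₀ + c) g st st' T := by
  refine ⟨h.sound, h.card, h.last, h.flag, fun R hU hR => ?_⟩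
  obtain ⟨h1, h2⟩ := hg R hU
  obtain ⟨h3, h4⟩ := h.run R hU hR
  exact ⟨h1.trans h3, by omega⟩

/-- Edges into `v` do not affect the vectors on the edges out of `v`. -/
theorem Network.big_insert {E : Finset (Edge N m)} {e : Edge N m} (h : G.Big U E e.dst)
    (hE : E ⊆ G.edges) (he : e ∈ G.edges) : G.Big U (insert e E) e.dst := by
  have hout : outEdges (Insert.insert e E) e.dst = outEdges E e.dst := by
    have hne := G.src_ne_dst he
    simp only [outEdges, edgeList, List.filter_filter]
    refine List.filter_congr fun f _ => ?_
    by_cases hf : f = e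
    · subst hf; simp [hne]
    · simp [hf]
  have hirv : ∀ f ∈ outEdges E e.dst, irvAux G.r G.port (Insert.insert e E) U N f =
      irvAux G.r G.port E U N f := by
    intro f hf
    rw [mem_outEdges] at hf
    have hd := G.depth_lt_card f.dst
    refine G.irvAux_congr (Finset.insert_subset he hE) hd hd (fun g hg => ?_)
      fun _ _ _ _ _ => rfl
    rw [Finset.mem_insert, or_iff_right]
    rintro rfl
    have h1 := G.depth_lt he
    have h2 := G.depth_lt (hE hf.1)
    rw [hf.2] at h2
    omega
  rw [Network.Big, hout, List.map_congr_left hirv]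
  exact h

/-- The cost of one membership test on a graph with at most `n` edges. -/
def testCost (C n l : ℕ) : ℕ := n * (2 * C) + l * (5 * C)

/-- A bound for the cost of a discovery: a test, and a new computation of the vectors. -/
def findCost (N C n l : ℕ) : ℕ := testCost C n l + N * (n * (n * (2 * C)))

/-- A bound for the cost of `FindNewEdge(v)` apart from discoveries. -/
def nodeCost (N C n l : ℕ) : ℕ := n * (n * (4 * C)) + N * testCost C n l

/-- The step of the inner loop of FIND-TOPO. -/
def tryEdge (r : Fin N) (port : Fin C → Fin N × Fin m) (cands : List (Fin C → F))
    (R : Codebook N m F) (v : Fin N) (st : State N m C F) (a : Fin N × Fin m) :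
    Ops (State N m C F) :=
  if a.1 ≠ v ∧ (a.1, v, a.2) ∉ st.edges ∧ ∀ j < a.2, (a.1, v, j) ∈ st.edges
  then checkIRV r port cands R v (a.1, v, a.2) st else pure st

theorem findNewEdge_eq (r : Fin N) (port : Fin C → Fin N × Fin m) (cands : List (Fin C → F))
    (R : Codebook N m F) (v : Fin N) (st : State N m C F) :
    findNewEdge r port cands R v st = (rankGtOne ((outEdges st.edges v).map st.irvs) >>=
      fun big => if big then ((List.finRange N).flatMap fun u =>
        (List.finRange m).map fun i => (u, i)).foldlM (tryEdge r port cands R v) st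
      else pure st) := rfl

variable (hD : findCost N C G.edges.card cands.length ≤ D)
include hD

/-- A single test either finds an edge of the network or leaves the state as it is. -/
theorem Network.leads_checkIRV {st : State N m C F} (hst : G.Sound U st) {e : Edge N m}
    (he : e ∉ st.edges) (hnum : ∀ j < e.num, (e.src, e.dst, j) ∈ st.edges)
    (hbig : G.Big U st.edges e.dst) :
    (∃ st' T, G.Leads U cands D 0 (fun R => checkIRV G.r G.port cands R e.dst e st) st st' T ∧
      st'.edges = insert e st.edges) ∨
    G.Leads U cands D (testCost C G.edges.card cands.length)
      (fun R => FindTopo.checkIRV G.r G.port cands R e.dst e st) st st ∅ := by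
  have hcard := Finset.card_le_card hst.sub
  have hcost : ∀ R : Codebook N m F, (combine R st.irvs e (outEdges st.edges e.dst)).cost +
      (inCands cands (combine R st.irvs e (outEdges st.edges e.dst)).val).cost ≤
        testCost C G.edges.card cands.length := fun R =>
    Nat.add_le_add ((combine_cost_le R _ e _ _).trans (Nat.mul_le_mul_right _ hcard))
      (inCands_cost_le _ _)
  have hval : ∀ R : Codebook N m F, (combine R st.irvs e (outEdges st.edges e.dst)).val =
      ∑ e' ∈ st.edges.filter (fun e' => e'.src = e.dst),
        coef R e e' • irvAux G.r G.port st.edges U N e' := fun R => by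
    rw [combine_outEdges_val]
    exact Finset.sum_congr rfl fun e' he' => by rw [hst.irvs e' (Finset.mem_filter.1 he').1]
  have reject : (∀ R, G.used R = U →
      (∀ E ∈ insert st.edges (∅ : Finset (Finset (Edge N m))), G.SafeAt cands R E) →
      (inCands cands (combine R st.irvs e (outEdges st.edges e.dst)).val).val = false) →
      G.Leads U cands D (testCost C G.edges.card cands.length)
        (fun R => FindTopo.checkIRV G.r G.port cands R e.dst e st) st st ∅ := by
    refine fun h => ⟨hst, by simp, by simp, .inl, fun R hU hR => ?_⟩
    have h1 := hcost R
    simp only [FindTopo.checkIRV, Ops.bind_val, Ops.bind_cost, h R hU hR]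
    refine ⟨rfl, ?_⟩
    simp only [Bool.false_eq_true, if_false, Ops.pure_cost]
    omega
  by_cases heG : e ∈ G.edges
  -- The test of an edge of the network involves only coefficients of `U`, so that its outcome is
  -- the same for all codebooks; other edges are rejected by `SafeAt`.
  · have hUval : ∀ R, G.used R = U → (combine R st.irvs e (outEdges st.edges e.dst)).val =
        (combine U st.irvs e (outEdges st.edges e.dst)).val := fun R hU => by
      rw [hval, hval]
      refine Finset.sum_congr rfl fun e' he' => ?_
      rw [Finset.mem_filter] at he'
      rw [Network.coef_eq_of_used hU heG (hst.sub he'.1) he'.2]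
    cases hok : (inCands cands (combine U st.irvs e (outEdges st.edges e.dst)).val).val with
    | false => exact .inr (reject fun R hU _ => by rw [hUval R hU, hok])
    | true =>
      have hE := Finset.insert_subset heG hst.sub
      have hE' := Finset.card_le_card hE
      refine .inl ⟨_, {insert e st.edges}, ⟨Network.sound_insert hst heG, ?_, by simp,
        fun _ => .inr ?_, fun R hU hR => ?_⟩, rfl⟩
      · simp [Finset.card_insert_of_notMem he, add_comm]
      · simp [Finset.card_insert_of_notMem he]
      · have h1 := hcost R
        have h2 := computeIRVs_cost_le G.r G.port U (insert e st.edges)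
        have h3 : N * ((insert e st.edges).card * ((insert e st.edges).card * (2 * C))) ≤
            N * (G.edges.card * (G.edges.card * (2 * C))) := by gcongr
        rw [hUval R hU] at h1
        simp only [FindTopo.checkIRV, Ops.bind_val, Ops.bind_cost, hUval R hU, hok, if_true,
          Network.computeIRVs_congr hU hE, Ops.pure_cost, Ops.pure_val,
          Finset.card_insert_of_notMem he, true_and]
        unfold findCost at hD
        rw [mul_add, mul_one]
        omega
  · refine .inr (reject fun R hU hR => ?_)
    have h := hR st.edges (by simp) e heG (fun j hj => hst.sub (hnum j hj))
    rw [hU] at h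
    rw [hval]
    exact h hbig

/-- After a failed test of the `i`-th parallel edge the later ones are no candidates, so that a node
`u` costs at most one failed test. -/
theorem Network.leads_parallel (u v : Fin N) (l : List (Fin m)) (hl : l.Pairwise (· < ·))
    {st : State N m C F} (hst : G.Sound U st) (hbig : G.Big U st.edges v) :
    ∃ st' T, G.Leads U cands D (testCost C G.edges.card cands.length)
      (fun R => l.foldlM (fun st i => tryEdge G.r G.port cands R v st (u, i)) st) st st' T ∧
      G.Big U st'.edges v := by
  induction l generalizing st with
  | nil => exact ⟨st, ∅, .pure hst _, hbig⟩
  | cons i l ih =>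
    rw [List.pairwise_cons] at hl
    simp only [List.foldlM_cons]
    by_cases hc : u ≠ v ∧ (u, v, i) ∉ st.edges ∧ ∀ j < i, (u, v, j) ∈ st.edges
    · have htry : ∀ R, tryEdge G.r G.port cands R v st (u, i) =
          checkIRV G.r G.port cands R v (u, v, i) st := fun R => if_pos hc
      simp only [htry]
      rcases Network.leads_checkIRV hD hst (e := (u, v, i)) hc.2.1 hc.2.2 hbig with
        ⟨st', T, h, he⟩ | h
      · have hG : (u, v, i) ∈ G.edges := h.sound.sub (he ▸ Finset.mem_insert_self _ _)
        have hbig' : G.Big U st'.edges v := by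
          rw [he]
          exact Network.big_insert (e := (u, v, i)) hbig hst.sub hG
        obtain ⟨st'', T', h', hb⟩ := ih hl.2 h.sound hbig'
        exact ⟨st'', _, (h.bind h').mono (Nat.zero_add _).le, hb⟩
      · have hdead : ∀ R, l.foldlM (fun st i => tryEdge G.r G.port cands R v st (u, i)) st =
            (Pure.pure st : Ops _) := by
          intro R
          have : ∀ l' : List (Fin m), (∀ a ∈ l', i < a) →
              l'.foldlM (fun st i => tryEdge G.r G.port cands R v st (u, i)) st =
                (Pure.pure st : Ops _) := by
            intro l' hl'
            induction l' with
            | nil => rfl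
            | cons a l' ih' =>
              have ha : tryEdge G.r G.port cands R v st (u, a) = Pure.pure st :=
                if_neg fun h => hc.2.1 (h.2.2 i (hl' a (by simp)))
              rw [List.foldlM_cons, ha, pure_bind]
              exact ih' fun b hb => hl' b (by simp [hb])
          exact this l hl.1
        refine ⟨st, _, (h.bind (c₂ := 0) (T₂ := ∅) ?_), hbig⟩
        simp only [hdead]
        exact .pure hst 0
    · have htry : ∀ R, tryEdge G.r G.port cands R v st (u, i) = Pure.pure st :=
        fun R => if_neg hc
      simp only [htry, pure_bind]
      exact ih hl.2 hst hbig

/-- The loop over the candidate edges into `v`. -/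
theorem Network.leads_tails (v : Fin N) (us : List (Fin N)) {st : State N m C F}
    (hst : G.Sound U st) (hbig : G.Big U st.edges v) :
    ∃ st' T, G.Leads U cands D (us.length * testCost C G.edges.card cands.length)
      (fun R => (us.flatMap fun u => (List.finRange m).map fun i => (u, i)).foldlM
        (tryEdge G.r G.port cands R v) st) st st' T := by
  induction us generalizing st with
  | nil => exact ⟨st, ∅, .pure hst _⟩
  | cons u us ih =>
    simp only [List.flatMap_cons, List.foldlM_append, List.foldlM_map]
    obtain ⟨st₁, T₁, h₁, hb⟩ := Network.leads_parallel hD u v _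
      (List.pairwise_lt_finRange m) hst hbig
    obtain ⟨st₂, T₂, h₂⟩ := ih h₁.sound hb
    refine ⟨st₂, _, (h₁.bind h₂).mono ?_⟩
    rw [List.length_cons, Nat.succ_mul, Nat.add_comm]

/-- The rank test of `FindNewEdge(v)` and the loop behind it. -/
theorem Network.leads_findNewEdge (v : Fin N) {st : State N m C F} (hst : G.Sound U st) :
    ∃ st' T, G.Leads U cands D (nodeCost N C G.edges.card cands.length)
      (fun R => findNewEdge G.r G.port cands R v st) st st' T := by
  have hcost : (rankGtOne ((outEdges st.edges v).map st.irvs)).cost ≤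
      G.edges.card * (G.edges.card * (4 * C)) := by
    have h := (length_outEdges_le st.edges v).trans (Finset.card_le_card hst.sub)
    refine (rankGtOne_cost_le _).trans ?_
    rw [List.length_map]
    gcongr
  have hbig : G.Big U st.edges v ↔
      (rankGtOne ((outEdges st.edges v).map st.irvs)).val = true := by
    rw [Network.Big, List.map_congr_left fun e he => hst.irvs e (mem_outEdges.1 he).1]
  simp only [findNewEdge_eq]
  cases hb : (rankGtOne ((outEdges st.edges v).map st.irvs)).val with
  | false =>
    refine ⟨st, ∅, (Network.Leads.pure hst (N * testCost C G.edges.card cands.length)).of_cost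
      fun R hU => ?_⟩
    rw [Ops.bind_val, Ops.bind_cost, hb]
    exact ⟨rfl, Nat.add_le_add_right hcost _⟩
  | true =>
    obtain ⟨st', T, h⟩ := Network.leads_tails hD v (List.finRange N) hst (hbig.2 hb)
    rw [List.length_finRange] at h
    refine ⟨st', T, h.of_cost fun R hU => ?_⟩
    rw [Ops.bind_val, Ops.bind_cost, hb]
    exact ⟨rfl, Nat.add_le_add_right hcost _⟩

/-- A round that ends with the flag set has found an edge. -/
theorem Network.leads_stepB {st : State N m C F} (hst : G.Sound U st) :
    ∃ st' T, G.Leads U cands D (N * nodeCost N C G.edges.card cands.length)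
      (fun R => stepB G.s G.r G.port cands R st) st st' T ∧
      (st'.newEdge = true → st.edges.card < st'.edges.card) := by
  have fold : ∀ (vs : List (Fin N)) {st : State N m C F}, G.Sound U st →
      ∃ st' T, G.Leads U cands D (vs.length * nodeCost N C G.edges.card cands.length)
        (fun R => vs.foldlM (fun st v => FindTopo.findNewEdge G.r G.port cands R v st) st)
        st st' T := by
    intro vs
    induction vs with
    | nil => exact fun hst => ⟨_, ∅, .pure hst _⟩
    | cons v vs ih =>
      intro st hst
      obtain ⟨st₁, T₁, h₁⟩ := Network.leads_findNewEdge hD v hst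
      obtain ⟨st₂, T₂, h₂⟩ := ih h₁.sound
      simp only [List.foldlM_cons]
      refine ⟨st₂, _, (h₁.bind h₂).mono ?_⟩
      rw [List.length_cons, Nat.succ_mul, Nat.add_comm]
  obtain ⟨st', T, h⟩ := fold ((List.finRange N).filter fun v => decide (v ∈ st.nodes ∧ v ≠ G.s))
    (st := { st with newEdge := false }) ⟨hst.sub, hst.init, hst.nodes, hst.irvs⟩
  have hflag : st'.newEdge = true → st.edges.card < st'.edges.card := by simpa using h.flag
  refine ⟨st', T, ⟨h.sound, h.card, h.last, fun h => .inr (hflag h), fun R hU hR => ?_⟩, hflag⟩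
  obtain ⟨h1, h2⟩ := h.run R hU hR
  refine ⟨h1, h2.trans (Nat.add_le_add_right (Nat.mul_le_mul_right _ ?_) _)⟩
  exact (List.length_filter_le _ _).trans (List.length_finRange).le

/-- Every round but the last finds an edge, so that the cost of these rounds can be charged to the
edges, and the fuel is never used up. The final state is the result of a round without a
discovery. -/
theorem Network.leads_loopB (fuel : ℕ) {st : State N m C F} (hst : G.Sound U st)
    (hfuel : G.edges.card < fuel + st.edges.card) :
    ∃ st' T, G.Leads U cands (N * nodeCost N C G.edges.card cands.length + D)
      (N * nodeCost N C G.edges.card cands.length)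
      (fun R => loopB G.s G.r G.port cands R fuel st) st st' T ∧ st'.newEdge = false ∧
      ∀ R, G.used R = U → (∀ E ∈ insert st.edges T, G.SafeAt cands R E) →
        ∃ st₀, (FindTopo.stepB G.s G.r G.port cands R st₀).val = st' := by
  induction fuel generalizing st with
  | zero =>
    have := Finset.card_le_card hst.sub
    omega
  | succ fuel ih =>
    obtain ⟨st₁, T₁, h₁, hprog⟩ := Network.leads_stepB hD hst
    have hmono := (Nat.le_add_left _ _).trans h₁.card
    cases hnew : st₁.newEdge with
    | false =>
      refine ⟨st₁, T₁, ⟨h₁.sound, h₁.card, h₁.last, by simp [hnew], fun R hU hR => ?_⟩, hnew,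
        fun R hU hR => ⟨st, (h₁.run R hU hR).1⟩⟩
      obtain ⟨hv, hc⟩ := h₁.run R hU hR
      simp only [FindTopo.loopB, Ops.bind_val, Ops.bind_cost, hv, hnew, Bool.false_eq_true,
        if_false, Ops.pure_val, Ops.pure_cost, true_and]
      have := Nat.mul_le_mul_left (N * nodeCost N C G.edges.card cands.length) hmono
      rw [add_mul, add_mul]
      linarith
    | true =>
      have hprog := hprog hnew
      obtain ⟨st₂, T₂, h₂, hnew₂, hlast⟩ := ih h₁.sound (by omega)
      have h₁' : G.Leads U cands (N * nodeCost N C G.edges.card cands.length + D) 0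
          (fun R => FindTopo.stepB G.s G.r G.port cands R st) st st₁ T₁ := by
        refine ⟨h₁.sound, h₁.card, h₁.last, h₁.flag, fun R hU hR => ?_⟩
        obtain ⟨hv, hc⟩ := h₁.run R hU hR
        refine ⟨hv, ?_⟩
        have := Nat.mul_le_mul_left (N * nodeCost N C G.edges.card cands.length) hprog
        rw [add_mul, add_mul]
        rw [Nat.succ_eq_add_one, mul_add, mul_one] at this
        linarith
      have hb := h₁'.bind (g := fun R st' => if st'.newEdge then
        FindTopo.loopB G.s G.r G.port cands R fuel st' else Pure.pure st')
        (c₂ := N * nodeCost N C G.edges.card cands.length) (st₂ := st₂) (T₂ := T₂)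
        (by simpa only [hnew, if_true] using h₂)
      refine ⟨st₂, _, hb.mono (Nat.zero_add _).le, hnew₂,
        fun R hU hR => hlast R hU fun E hE => hR E ?_⟩
      have := h₁.last
      simp only [Finset.mem_insert, Finset.mem_union] at *
      rcases hE with rfl | hE <;> tauto

end

/-! ### The last round -/

section

/-- If every step that leaves the state in `Q` has left it unchanged, then so has a fold that ends
in `Q`. -/
theorem foldlM_fixed {σ α : Type} {f : σ → α → Ops σ} {Q : σ → Prop}
    (h : ∀ s a, Q (f s a).val → (f s a).val = s) (l : List α) (s : σ)
    (hs : Q (l.foldlM f s).val) :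
    (l.foldlM f s).val = s ∧ ∀ a ∈ l, (f s a).val = s := by
  induction l generalizing s with
  | nil => exact ⟨rfl, by simp⟩
  | cons a l ih =>
    rw [List.foldlM_cons, Ops.bind_val] at hs ⊢
    obtain ⟨h1, h2⟩ := ih _ hs
    rw [h1] at hs
    have h3 := h s a hs
    rw [h3] at h1 h2 ⊢
    exact ⟨h1, by simpa [h3] using h2⟩

variable {N m C : ℕ} {F : Type} [Field F] [DecidableEq F]

theorem checkIRV_val (r : Fin N) (port : Fin C → Fin N × Fin m) (cands : List (Fin C → F))
    (R : Codebook N m F) (v : Fin N) (e : Edge N m) (st : State N m C F) :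
    (checkIRV r port cands R v e st).val =
      if (inCands cands (combine R st.irvs e (outEdges st.edges v)).val).val then
        ⟨insert e.src st.nodes, insert e st.edges,
          (computeIRVs r port R (insert e st.edges)).val, true⟩
      else st := by
  simp only [checkIRV, Ops.bind_val]
  split_ifs <;> rfl

theorem tryEdge_fixed (r : Fin N) (port : Fin C → Fin N × Fin m) (cands : List (Fin C → F))
    (R : Codebook N m F) (v : Fin N) (st : State N m C F) (a : Fin N × Fin m)
    (h : (tryEdge r port cands R v st a).val.newEdge = false) :
    (tryEdge r port cands R v st a).val = st := by
  unfold tryEdge at h ⊢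
  split_ifs at h ⊢ with hc
  · rw [checkIRV_val] at h ⊢
    split_ifs at h ⊢
    rfl
  · rfl

theorem findNewEdge_fixed (r : Fin N) (port : Fin C → Fin N × Fin m) (cands : List (Fin C → F))
    (R : Codebook N m F) (v : Fin N) (st : State N m C F)
    (h : (findNewEdge r port cands R v st).val.newEdge = false) :
    (findNewEdge r port cands R v st).val = st := by
  rw [findNewEdge_eq, Ops.bind_val] at h ⊢
  split_ifs at h ⊢ with hb
  · exact (foldlM_fixed (Q := fun st => st.newEdge = false)
      (tryEdge_fixed r port cands R v) _ st h).1
  · rfl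

/-- After a round without a discovery, every candidate edge fails its test. -/
theorem stepB_fixed {s r : Fin N} {port : Fin C → Fin N × Fin m} {cands : List (Fin C → F)}
    {R : Codebook N m F} {st₀ st : State N m C F} (hst : (stepB s r port cands R st₀).val = st)
    (hnew : st.newEdge = false) {e : Edge N m} (hv : e.dst ∈ st.nodes) (hs : e.dst ≠ s)
    (hbig : (rankGtOne ((outEdges st.edges e.dst).map st.irvs)).val = true)
    (hne : e.src ≠ e.dst) (he : e ∉ st.edges)
    (hnum : ∀ j < e.num, (e.src, e.dst, j) ∈ st.edges) :
    (inCands cands (combine R st.irvs e (outEdges st.edges e.dst)).val).val = false := by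
  obtain ⟨h1, h2⟩ := foldlM_fixed (Q := fun st => st.newEdge = false)
    (fun st v => findNewEdge_fixed r port cands R v st) _ { st₀ with newEdge := false }
    (show (stepB s r port cands R st₀).val.newEdge = false by rw [hst, hnew])
  have h0 : { st₀ with newEdge := false } = st := h1.symm.trans hst
  rw [h0] at h2
  have hnodes : st₀.nodes = st.nodes := by rw [← h0]
  have h3 := h2 e.dst (by simp [hnodes, hv, hs])
  rw [findNewEdge_eq, Ops.bind_val, hbig, if_pos rfl] at h3
  have h4 := (foldlM_fixed (Q := fun st => st.newEdge = false)
    (tryEdge_fixed r port cands R e.dst) _ st (by rw [h3, hnew])).2 (e.src, e.num) (by simp)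
  have hc : e.src ≠ e.dst ∧ (e.src, e.dst, e.num) ∉ st.edges ∧
    ∀ j < e.num, (e.src, e.dst, j) ∈ st.edges := ⟨hne, he, hnum⟩
  rw [tryEdge, if_pos hc, checkIRV_val] at h4
  by_contra hok
  rw [Bool.not_eq_false] at hok
  have hee : ((e.src, e.dst, e.num) : Edge N m) = e := rfl
  rw [hee, hok, if_pos rfl] at h4
  have h5 := congrArg State.newEdge h4
  rw [hnew] at h5
  simp at h5

/-- If the impulse response vectors are generic and all pass the membership test, then a round
without a discovery ends with the whole network: otherwise a missing edge of least depth would have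
been found. -/
theorem Network.Sound.complete {G : Network N m C} {cands : List (Fin C → F)}
    {R : Codebook N m F} {st₀ st : State N m C F} (hS : G.Sound (G.used R) st)
    (hst : (stepB G.s G.r G.port cands R st₀).val = st) (hnew : st.newEdge = false)
    (hR : G.Generic R) (hA : ∀ e ∈ G.edges, (inCands cands (G.irv R e)).val = true) :
    st.nodes = Finset.univ ∧ st.edges = G.edges := by
  suffices h : G.edges ⊆ st.edges by
    have h' := Finset.Subset.antisymm hS.sub h
    refine ⟨Finset.eq_univ_of_forall fun v => (hS.nodes v).2 ?_, h'⟩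
    by_cases hv : v = G.r
    · exact .inl hv
    · rw [h']
      exact .inr (.inr (G.exists_out hv))
  by_contra hsub
  rw [← Finset.sdiff_nonempty] at hsub
  -- Among the missing edges whose heads have the least depth, the first of a bundle of parallel
  -- edges is a candidate.
  obtain ⟨e₀, he₀, hmin₀⟩ := Finset.exists_min_image _ (fun e => G.depth e.dst) hsub
  obtain ⟨e, he, hmin⟩ := Finset.exists_min_image
    ((G.edges \ st.edges).filter fun e => e.src = e₀.src ∧ e.dst = e₀.dst) (fun e => e.num)
    ⟨e₀, by simpa using he₀⟩
  simp only [Finset.mem_filter, Finset.mem_sdiff] at he hmin hmin₀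
  obtain ⟨⟨heG, heE⟩, hsrc, hdst⟩ := he
  have hfound : ∀ f ∈ G.edges, G.depth f.dst < G.depth e.dst → f ∈ st.edges := by
    intro f hf hd
    by_contra hfE
    have := hmin₀ f ⟨hf, hfE⟩
    rw [hdst] at hd
    omega
  have hr : e.dst ≠ G.r := fun h => heE (hS.init e heG h)
  have hs := G.dst_ne_s heG
  have hout : ∀ f ∈ G.edges, f.src = e.dst → f ∈ st.edges := fun f hf h =>
    hfound f hf (h ▸ G.depth_lt hf)
  have hirv : ∀ f ∈ G.edges, f.src = e.dst → st.irvs f = G.irv R f := by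
    intro f hf h
    have hd := G.depth_lt_card f.dst
    rw [hS.irvs f (hout f hf h), ← G.irv_used hf]
    refine G.irvAux_congr hS.sub hd hd (fun g hg => ⟨fun h => hS.sub h, fun hg' => ?_⟩)
      fun _ _ _ _ _ => rfl
    refine hfound g hg' ?_
    have h1 := G.depth_lt hg'
    have h2 := G.depth_lt hf
    rw [h] at h2
    omega
  have hfail := stepB_fixed hst hnew (e := e) ?_ hs ?_ (G.src_ne_dst heG) heE ?_
  · have hval : (combine R st.irvs e (outEdges st.edges e.dst)).val = G.irv R e := by
      rw [combine_outEdges_val, G.irv_eq_sum hr]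
      have hf : st.edges.filter (fun e' => e'.src = e.dst) =
          G.edges.filter (fun e' => e'.src = e.dst) := by
        ext f
        simp only [Finset.mem_filter]
        exact and_congr_left fun h => ⟨fun h' => hS.sub h', fun h' => hout f h' h⟩
      rw [hf]
      refine Finset.sum_congr rfl fun f hf => ?_
      rw [Finset.mem_filter] at hf
      rw [hirv f hf.1 hf.2]
    rw [hval, hA e heG] at hfail
    exact Bool.noConfusion hfail
  · obtain ⟨f, hf, h⟩ := G.exists_out hr
    exact (hS.nodes _).2 (.inr (.inr ⟨f, hout f hf h, h⟩))
  · obtain ⟨e₁, he₁, e₂, he₂, hs₁, hs₂, hne, hd⟩ := G.exists_two_out hs hr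
    refine (rankGtOne_val _).2 ⟨_, List.mem_map_of_mem (mem_outEdges.2 ⟨hout _ he₂ hs₂, hs₂⟩), _,
      List.mem_map_of_mem (mem_outEdges.2 ⟨hout _ he₁ hs₁, hs₁⟩), ?_, ?_⟩
    · rw [hirv e₂ he₂ hs₂]
      exact (hR.independent he₂).1
    · rw [hirv e₁ he₁ hs₁, hirv e₂ he₂ hs₂]
      exact (hR.independent he₁).2 e₂ he₂ hne.symm hd
  · intro j hj
    by_contra hjE
    have h := hmin (e.src, e.dst, j) ⟨⟨G.numbered _ _ _ _ heG hj, hjE⟩, hsrc, hdst⟩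
    exact absurd hj (not_lt.2 h)

/-- The bound for the cost of FIND-TOPO on `N` nodes and `n` edges with `l` candidate lines. -/
def totalCost (N C n l : ℕ) : ℕ :=
  N * nodeCost N C n l + (N * nodeCost N C n l + findCost N C n l) * n

/-- For given coefficients of the network and a given candidate set, few graphs can be reached, and
FIND-TOPO succeeds for every generic codebook that is safe at these graphs. -/
theorem Network.exists_graphs (G : Network N m C) (U : Codebook N m F)
    (cands : List (Fin C → F)) :
    ∃ T : Finset (Finset (Edge N m)), T.card ≤ G.edges.card + 1 ∧
      ∀ R, G.used R = U → (∀ E ∈ T, G.SafeAt cands R E) → G.Generic R →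
        (∀ e ∈ G.edges, (inCands cands (G.irv R e)).val = true) →
        (findTopo G.s G.r G.port cands R).val.nodes = Finset.univ ∧
        (findTopo G.s G.r G.port cands R).val.edges = G.edges ∧
        (findTopo G.s G.r G.port cands R).cost ≤ totalCost N C G.edges.card cands.length := by
  have hfuel : G.edges.card < N * N * m + 1 +
      (initState G.s G.r G.port : State N m C F).edges.card := by
    have h := Finset.card_le_univ G.edges
    rw [Fintype.card_prod, Fintype.card_prod, Fintype.card_fin, Fintype.card_fin, ← mul_assoc] at h
    omega
  obtain ⟨st, T, hL, hnew, hlast⟩ := Network.leads_loopB (cands := cands)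
    (D := findCost N C G.edges.card cands.length) le_rfl (N * N * m + 1)
    (G.sound_initState U) hfuel
  have hcard := Finset.card_le_card hL.sound.sub
  refine ⟨insert (initState G.s G.r G.port : State N m C F).edges T,
    (Finset.card_insert_le _ _).trans (Nat.add_le_add_right ?_ 1),
    fun R hU hR hgen hA => ?_⟩
  · have := hL.card
    omega
  obtain ⟨hv, hc⟩ := hL.run R hU hR
  obtain ⟨st₀, hst₀⟩ := hlast R hU hR
  obtain ⟨h1, h2⟩ := Network.Sound.complete (hU ▸ hL.sound) hst₀ hnew hgen hA
  have hv' : (findTopo G.s G.r G.port cands R).val = st := hv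
  rw [hv']
  refine ⟨h1, h2, ((Nat.le_add_right _ _).trans hc).trans ?_⟩
  rw [totalCost]
  gcongr

end

/-! ### The candidate set -/

section
variable {N m C k t : ℕ} {F : Type} [Field F] (G : Network N m C)

theorem Network.cand_used (R : Codebook N m F) (g : Fin t → Generation N m C k F) :
    G.cand (G.used R) g = G.cand R g := by
  have h : ∀ i, G.received (G.used R) (g i) = G.received R (g i) := by
    intro i
    rw [Network.received, Network.received, Network.transform, Network.transform]
    congr 1
    · congr 1
      exact Finset.sum_congr rfl fun e he => by rw [G.irv_used (Finset.mem_filter.1 he).1]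
    · exact Finset.sum_congr rfl fun e he => by rw [G.irv_used he]
  simp only [Network.cand, h]

theorem Network.finrank_cand (R : Codebook N m F) (g : Fin t → Generation N m C k F) :
    ∀ L ∈ G.cand R g, Module.finrank F L = 1 := by
  intro L hL
  exact (Finset.mem_filter.1 hL).2

/-- There is at most one candidate line for each pair of generations. -/
theorem Network.card_cand_le (R : Codebook N m F) (g : Fin t → Generation N m C k F) :
    (G.cand R g).card ≤ t * t := by
  refine (Finset.card_filter_le _ _).trans (Finset.card_image_le.trans ?_)
  refine (Finset.card_le_univ _).trans ?_
  simp

variable {G}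

theorem Network.CandComplete.generations_pos {R : Codebook N m F}
    {g : Fin t → Generation N m C k F} (h : G.CandComplete R g) : 0 < t := by
  obtain ⟨e, he⟩ := Finset.card_pos.1 G.one_le_edges
  have hc := (Finset.card_pos.2 ⟨_, h e he⟩).trans_le (G.card_cand_le R g)
  exact Nat.pos_of_mul_pos_left hc

variable [DecidableEq F]

/-- The lines of a complete candidate set are one-dimensional, so that no vector of the network
vanishes, and all of them pass the membership test. -/
theorem Network.CandComplete.inCands {R : Codebook N m F} {g : Fin t → Generation N m C k F}
    (h : G.CandComplete R g) {e : Edge N m} (he : e ∈ G.edges) :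
    (inCands (encode (G.cand R g)) (G.irv R e)).val = true := by
  refine (inCands_encode (G.finrank_cand R g) _).2 ⟨fun h0 => ?_, _, h e he,
    Submodule.mem_span_singleton_self _⟩
  have h1 := G.finrank_cand R g _ (h e he)
  rw [h0, Submodule.span_zero_singleton, finrank_bot] at h1
  exact zero_ne_one h1

end

/-! ### Counting codebooks -/

section
variable {N m C : ℕ} {F : Type} [Fintype F]

/-- If at most one value of the coefficient from `e` to `e'` puts a codebook into `S`, then `S` is
smaller by the factor `q` than any set that contains all changes of its elements. -/
theorem card_mul_le {S S' : Finset (Codebook N m F)} (e e' : Edge N m)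
    (h₁ : ∀ R ∈ S, ∀ a, setCoef R e e' a ∈ S')
    (h₂ : ∀ R ∈ S, ∀ a, setCoef R e e' a ∈ S → a = coef R e e') :
    S.card * Fintype.card F ≤ S'.card := by
  rw [← Finset.card_univ, ← Finset.card_product]
  refine Finset.card_le_card_of_injOn (fun p => setCoef p.1 e e' p.2) ?_ ?_
  · rintro ⟨R, a⟩ h
    exact h₁ R (Finset.mem_product.1 h).1 a
  · rintro ⟨R, a⟩ h ⟨R', a'⟩ h' heq
    have hR := (Finset.mem_product.1 (Finset.mem_coe.1 h)).1
    have hR' := (Finset.mem_product.1 (Finset.mem_coe.1 h')).1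
    simp only at heq hR hR'
    have ha : a = a' := by rw [← coef_setCoef_self R e e' a, heq, coef_setCoef_self]
    subst ha
    have h3 : setCoef R e e' (coef R' e e') = R' := by
      rw [← setCoef_setCoef R e e' a, heq, setCoef_setCoef, setCoef_coef]
    have h4 := h₂ R hR _ (h3.symm ▸ hR')
    rw [h4, setCoef_coef] at h3
    rw [h3]

variable [Field F] (G : Network N m C)

open Classical in
/-- Given the other coefficients, the one from `e` to an `e'` off a line has at most one value that
puts the vector of `e` on this line. The number of triples of edges bounds the number of such
events. -/
theorem Network.card_not_generic :
    ({R | ¬ G.Generic R} : Finset (Codebook N m F)).card * Fintype.card F ≤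
      G.edges.card ^ 3 * Fintype.card (Codebook N m F) := by
  let S : Edge N m × Edge N m × Edge N m → Finset (Codebook N m F) := fun p =>
    {R | p.1.dst ≠ G.r ∧ p.2.1.src = p.1.dst ∧ p.2.2 ≠ p.1 ∧
      G.depth p.2.2.dst ≤ G.depth p.1.dst ∧ G.irv R p.2.1 ∉ Submodule.span F {G.irv R p.2.2} ∧
      G.irv R p.1 ∈ Submodule.span F {G.irv R p.2.2}}
  have hsub : ({R | ¬ G.Generic R} : Finset (Codebook N m F)) ⊆
      (G.edges ×ˢ G.edges ×ˢ G.edges).biUnion S := by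
    intro R hR
    replace hR := (Finset.mem_filter.1 hR).2
    simp only [Network.Generic] at hR
    push Not at hR
    obtain ⟨e, he, hr, e', he', hs, e'', he'', hne, hd, h1, h2⟩ := hR
    simp only [Finset.mem_biUnion, Finset.mem_product]
    exact ⟨(e, e', e''), ⟨he, he', he''⟩, by simp [S, *]⟩
  refine (Nat.mul_le_mul_right _ ((Finset.card_le_card hsub).trans Finset.card_biUnion_le)).trans ?_
  rw [Finset.sum_mul]
  refine (Finset.sum_le_card_nsmul _ _ (Fintype.card (Codebook N m F)) ?_).trans (le_of_eq ?_)
  · rintro ⟨e, e', e''⟩ hp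
    simp only [Finset.mem_product] at hp
    obtain ⟨he, he', he''⟩ := hp
    refine card_mul_le e e' (fun R _ a => Finset.mem_univ _) fun R hR a hRa => ?_
    simp only [S, Finset.mem_filter, Finset.mem_univ, true_and] at hR hRa
    obtain ⟨hr, hs, hne, hd, hm', hm⟩ := hR
    have hRa := hRa.2.2.2.2.2
    rw [G.irv_setCoef R hs hne hd, G.irv_eq_sum hr] at hRa
    rw [G.irv_eq_sum hr] at hm
    refine eq_coef_of_sum_mem (f := G.irv R) (fun f hf => (Finset.mem_filter.1 hf).2)
      (Finset.mem_filter.2 ⟨he', hs⟩) hm' hm ?_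
    convert hRa using 1
    refine Finset.sum_congr rfl fun f hf => ?_
    rw [Finset.mem_filter] at hf
    have hd := G.depth_lt hf.1
    rw [hf.2] at hd
    rw [G.irv_setCoef R hs (fun h => lt_irrefl _ (h ▸ hd)) hd.le]
  · simp only [Finset.card_product, smul_eq_mul]
    ring

open Classical in
/-- At each of the graphs in `T`, every pair of nodes gives at most one test of an edge that does
not exist, and each candidate line is hit with probability at most `1 / q`, independently of the
coefficients that the network uses. -/
theorem Network.card_not_safe [DecidableEq F] (U : Codebook N m F)
    (I : Finset (Submodule F (Fin C → F))) (hI : ∀ L ∈ I, Module.finrank F L = 1)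
    (T : Finset (Finset (Edge N m))) :
    ({R | G.used R = U ∧ ∃ E ∈ T, ¬ G.SafeAt (encode I) R E} :
      Finset (Codebook N m F)).card * Fintype.card F ≤
      T.card * (N * N * I.card) * ({R | G.used R = U} : Finset (Codebook N m F)).card := by
  -- The first parallel edge that the network does not have, for each pair of nodes.
  let Z : Finset (Edge N m) :=
    {e | e ∉ G.edges ∧ ∀ j < e.num, (e.src, e.dst, j) ∈ G.edges}
  have hZ : Z.card ≤ N * N := by
    have h : Z.card ≤ (Finset.univ : Finset (Fin N × Fin N)).card := by
      refine Finset.card_le_card_of_injOn (fun e => (e.src, e.dst)) (by simp) ?_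
      rintro ⟨u, v, i⟩ h ⟨u', v', i'⟩ h' heq
      simp only [Edge.src, Edge.dst, Prod.mk.injEq] at heq
      obtain ⟨rfl, rfl⟩ := heq
      replace h := (Finset.mem_filter.1 (Finset.mem_coe.1 h)).2
      replace h' := (Finset.mem_filter.1 (Finset.mem_coe.1 h')).2
      simp only [Edge.src, Edge.dst, Edge.num] at h h'
      rcases lt_trichotomy i i' with hlt | rfl | hlt
      · exact absurd (h'.2 i hlt) h.1
      · rfl
      · exact absurd (h.2 i' hlt) h'.1
    simpa using h
  let f : Finset (Edge N m) → Edge N m → Fin C → F := fun E => irvAux G.r G.port E U N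
  let S : Finset (Edge N m) × Edge N m × Submodule F (Fin C → F) → Finset (Codebook N m F) :=
    fun p => {R | G.used R = U ∧ G.Big U p.1 p.2.1.dst ∧
      ∑ e' ∈ p.1.filter (fun e' => e'.src = p.2.1.dst), coef R p.2.1 e' • f p.1 e' ∈ p.2.2}
  have hsub : ({R | G.used R = U ∧ ∃ E ∈ T, ¬ G.SafeAt (encode I) R E} :
      Finset (Codebook N m F)) ⊆ (T ×ˢ Z ×ˢ I).biUnion S := by
    intro R hR
    simp only [Finset.mem_filter, Finset.mem_univ, true_and] at hR
    obtain ⟨hU, E, hE, hR⟩ := hR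
    simp only [Network.SafeAt] at hR
    push Not at hR
    obtain ⟨e, he, hnum, hbig, h⟩ := hR
    rw [ne_eq, Bool.not_eq_false, inCands_encode hI] at h
    obtain ⟨-, L, hL, h⟩ := h
    rw [hU] at hbig h
    simp only [Finset.mem_biUnion, Finset.mem_product]
    exact ⟨(E, e, L), ⟨hE, by simpa [Z] using ⟨he, hnum⟩, hL⟩, by
      simpa only [S, Finset.mem_filter, Finset.mem_univ, true_and] using ⟨hU, hbig, h⟩⟩
  refine (Nat.mul_le_mul_right _ ((Finset.card_le_card hsub).trans Finset.card_biUnion_le)).trans ?_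
  rw [Finset.sum_mul]
  refine (Finset.sum_le_card_nsmul _ _
    ({R | G.used R = U} : Finset (Codebook N m F)).card ?_).trans ?_
  · rintro ⟨E, e, L⟩ hp
    simp only [Finset.mem_product, Z, Finset.mem_filter, Finset.mem_univ, true_and] at hp
    obtain ⟨-, ⟨he, -⟩, hL⟩ := hp
    by_cases hbig : G.Big U E e.dst
    -- The line misses the vector of some `e₀`; the coefficient from `e` to `e₀` is the random one.
    · obtain ⟨e₀, he₀, hs₀, hm₀⟩ : ∃ e₀ ∈ E, e₀.src = e.dst ∧ f E e₀ ∉ L := by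
        obtain ⟨h, hh, x, hx, h0, hxh⟩ := (rankGtOne_val _).1 hbig
        obtain ⟨e₁, he₁, rfl⟩ := List.mem_map.1 hh
        obtain ⟨e₂, he₂, rfl⟩ := List.mem_map.1 hx
        rw [mem_outEdges] at he₁ he₂
        rw [← (span_generator (hI L hL)).2]
        rcases not_mem_span_or (y := generator L) h0 hxh with h | h
        exacts [⟨e₂, he₂.1, he₂.2, h⟩, ⟨e₁, he₁.1, he₁.2, h⟩]
      refine card_mul_le e e₀ (fun R hR a => ?_) fun R hR a hRa => ?_
      · simp only [S, Finset.mem_filter, Finset.mem_univ, true_and] at hR ⊢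
        rw [G.used_setCoef R he, hR.1]
      · simp only [S, Finset.mem_filter, Finset.mem_univ, true_and] at hR hRa
        exact eq_coef_of_sum_mem (fun f hf => (Finset.mem_filter.1 hf).2)
          (Finset.mem_filter.2 ⟨he₀, hs₀⟩) hm₀ hR.2.2 hRa.2.2
    · have : S (E, e, L) = ∅ := by
        refine Finset.filter_eq_empty_iff.2 fun R _ h => hbig h.2.1
      rw [this]
      simp
  · simp only [Finset.card_product, smul_eq_mul]
    gcongr

variable {k t : ℕ}

/-! ### Probabilities -/

/-- The codebook is uniform. -/
theorem Network.prob_codebook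
    (noise : Codebook N m F → PMF (Fin t → Generation N m C k F)) (S : Finset (Codebook N m F)) :
    prob (G.law noise) {ω | ω.1 ∈ S} = S.card / Fintype.card (Codebook N m F) := by
  classical
  have h : (G.law noise).map Prod.fst = PMF.uniformOfFintype (Codebook N m F) := by
    rw [Network.law, PMF.map_bind]
    conv_rhs => rw [← PMF.bind_pure (PMF.uniformOfFintype (Codebook N m F))]
    congr 1
    funext R
    rw [PMF.map_comp]
    exact PMF.map_const _ _
  have h2 : (G.law noise).toOuterMeasure {ω | ω.1 ∈ S} =
      (PMF.uniformOfFintype (Codebook N m F)).toOuterMeasure S := by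
    rw [← h, PMF.toOuterMeasure_map_apply]
    rfl
  rw [prob, h2, PMF.toOuterMeasure_uniformOfFintype_apply]
  simp

open Classical in
/-- A bound for an event that holds for the entries outside the network, given the coefficients of
the network, the messages and the errors, holds for the joint law. -/
theorem Network.prob_le_of_used
    (noise : Codebook N m F → PMF (Fin t → Generation N m C k F))
    (B : Set (Codebook N m F × (Fin t → Generation N m C k F))) (n : ℕ)
    (h : ∀ U g, ({R | G.used R = U ∧ (R, g) ∈ B} : Finset (Codebook N m F)).card *
      Fintype.card F ≤ n * ({R | G.used R = U} : Finset (Codebook N m F)).card) :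
    prob (G.law noise) B ≤ n / Fintype.card F := by
  set M : ℝ := n / Fintype.card F with hMdef
  have hM : 0 ≤ M := by positivity
  have hq : (0 : ℝ) < Fintype.card F := by exact_mod_cast Fintype.card_pos
  replace h : ∀ U g, (({R | G.used R = U ∧ (R, g) ∈ B} : Finset (Codebook N m F)).card : ℝ) ≤
      M * ({R | G.used R = U} : Finset (Codebook N m F)).card := fun U g => by
    rw [hMdef, div_mul_eq_mul_div, le_div_iff₀ hq]
    exact_mod_cast h U g
  refine ENNReal.toReal_le_of_le_ofReal hM ?_
  have h' : ∀ U g, (({R | G.used R = U ∧ (R, g) ∈ B} : Finset (Codebook N m F)).card : ENNReal) ≤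
      ENNReal.ofReal M * ({R | G.used R = U} : Finset (Codebook N m F)).card := by
    intro U g
    have := ENNReal.ofReal_le_ofReal (h U g)
    rwa [ENNReal.ofReal_mul hM, ENNReal.ofReal_natCast, ENNReal.ofReal_natCast] at this
  set c : ENNReal := (Fintype.card (Codebook N m F) : ENNReal)⁻¹ with hc
  have h1 : (G.law noise).toOuterMeasure B =
      c * ∑' g, ∑ R, if (R, g) ∈ B then noise (G.used R) g else 0 := by
    have hR : ∀ R, ((noise (G.used R)).map (Prod.mk R)).toOuterMeasure B =
        ∑' g, if (R, g) ∈ B then noise (G.used R) g else 0 := fun R => by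
      rw [PMF.toOuterMeasure_map_apply, PMF.toOuterMeasure_apply]
      rfl
    rw [Network.law, PMF.toOuterMeasure_bind_apply, tsum_fintype]
    simp only [PMF.uniformOfFintype_apply, hR, ← hc]
    rw [← Finset.mul_sum, Summable.tsum_finsetSum fun _ _ => ENNReal.summable]
  have h2 : ∀ g, (∑ R, if (R, g) ∈ B then noise (G.used R) g else 0) ≤
      ENNReal.ofReal M * ∑ R, noise (G.used R) g := by
    intro g
    rw [← Finset.sum_fiberwise (Finset.univ : Finset (Codebook N m F)) G.used,
      ← Finset.sum_fiberwise (Finset.univ : Finset (Codebook N m F)) G.used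
        (fun R => noise (G.used R) g), Finset.mul_sum]
    refine Finset.sum_le_sum fun U _ => ?_
    have e1 : (∑ R with G.used R = U, if (R, g) ∈ B then noise (G.used R) g else 0) =
        (({R | G.used R = U ∧ (R, g) ∈ B} : Finset (Codebook N m F)).card : ENNReal) *
          noise U g := by
      rw [← Finset.sum_filter, Finset.filter_filter, ← nsmul_eq_mul, ← Finset.sum_const]
      exact Finset.sum_congr rfl fun R hR => by rw [(Finset.mem_filter.1 hR).2.1]
    have e2 : (∑ R with G.used R = U, noise (G.used R) g) =
        (({R | G.used R = U} : Finset (Codebook N m F)).card : ENNReal) * noise U g := by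
      rw [← nsmul_eq_mul, ← Finset.sum_const]
      exact Finset.sum_congr rfl fun R hR => by rw [(Finset.mem_filter.1 hR).2]
    rw [e1, e2, ← mul_assoc]
    gcongr
    exact h' U g
  calc (G.law noise).toOuterMeasure B
      ≤ c * ∑' g, ENNReal.ofReal M * ∑ R, noise (G.used R) g := by
        rw [h1]
        gcongr with g
        exact h2 g
    _ = ENNReal.ofReal M * (c * ∑ R : Codebook N m F, ∑' g, noise (G.used R) g) := by
        rw [ENNReal.tsum_mul_left, Summable.tsum_finsetSum fun _ _ => ENNReal.summable]
        ring
    _ = ENNReal.ofReal M := by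
        simp only [PMF.tsum_coe, Finset.sum_const, Finset.card_univ, nsmul_eq_mul, mul_one]
        rw [hc, ENNReal.inv_mul_cancel (by simp) (by simp), mul_one]

end

/-! ### The error probability and the cost -/

section
variable {Ω : Type} (p : PMF Ω)

theorem toOuterMeasure_ne_top (A : Set Ω) : p.toOuterMeasure A ≠ ⊤ := by
  refine ne_top_of_le_ne_top ENNReal.one_ne_top ?_
  exact (p.toOuterMeasure.mono (Set.subset_univ A)).trans
    ((p.toOuterMeasure_apply_eq_one_iff _).2 (Set.subset_univ _)).le

theorem prob_mono {A B : Set Ω} (h : A ⊆ B) : prob p A ≤ prob p B :=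
  ENNReal.toReal_mono (toOuterMeasure_ne_top p B) (p.toOuterMeasure.mono h)

theorem prob_union_le (A B : Set Ω) : prob p (A ∪ B) ≤ prob p A + prob p B := by
  rw [prob, prob, prob, ← ENNReal.toReal_add (toOuterMeasure_ne_top p A)
    (toOuterMeasure_ne_top p B)]
  exact ENNReal.toReal_mono
    (ENNReal.add_ne_top.2 ⟨toOuterMeasure_ne_top p A, toOuterMeasure_ne_top p B⟩)
    (MeasureTheory.measure_union_le _ _)

theorem prob_univ : prob p Set.univ = 1 := by
  rw [prob, (p.toOuterMeasure_apply_eq_one_iff _).2 (Set.subset_univ _), ENNReal.toReal_one]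

end

section
variable {N m C k t : ℕ} {F : Type} [Field F] [Fintype F] [DecidableEq F] (G : Network N m C)

/-- The implication fails only if the codebook is not generic or a false edge passes its test. -/
theorem Network.prob_fail_le (noise : Codebook N m F → PMF (Fin t → Generation N m C k F)) (B : ℝ)
    (hB : ∀ l ≤ t * t, (totalCost N C G.edges.card l : ℝ) ≤ B) :
    prob (G.law noise) (G.completeEvent \ G.recoverEvent B) ≤
      ((G.edges.card + 1) * (N * N * (t * t)) + (G.edges.card : ℝ) ^ 3) / Fintype.card F := by
  classical
  have hq : (0 : ℝ) < Fintype.card F := by exact_mod_cast Fintype.card_pos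
  choose T hT hrun using fun U : Codebook N m F => G.exists_graphs U
  let B₁ : Set (Codebook N m F × (Fin t → Generation N m C k F)) :=
    {ω | ∃ E ∈ T (G.used ω.1) (encode (G.cand ω.1 ω.2)),
      ¬ G.SafeAt (encode (G.cand ω.1 ω.2)) ω.1 E}
  let S : Finset (Codebook N m F) := {R | ¬ G.Generic R}
  have hsub : G.completeEvent \ G.recoverEvent B ⊆ B₁ ∪ {ω | ω.1 ∈ S} := by
    rintro ⟨R, g⟩ ⟨hA, hS⟩
    by_contra hno
    simp only [B₁, S, Set.mem_union, Set.mem_ofPred_eq, Finset.mem_filter, Finset.mem_univ,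
      true_and, not_or, not_exists, not_and, not_not] at hno
    obtain ⟨h1, h2, h3⟩ := hrun (G.used R) (encode (G.cand R g)) R rfl hno.1 hno.2
      fun e he => Network.CandComplete.inCands hA he
    refine hS ⟨h1, h2, (Nat.cast_le.2 h3).trans (hB _ ?_)⟩
    rw [length_encode]
    exact G.card_cand_le R g
  have h₁ : prob (G.law noise) B₁ ≤
      (G.edges.card + 1) * (N * N * (t * t)) / Fintype.card F := by
    have h := G.prob_le_of_used noise B₁ ((G.edges.card + 1) * (N * N * (t * t))) fun U g => ?_
    · exact_mod_cast h
    have hs : ({R | G.used R = U ∧ (R, g) ∈ B₁} : Finset (Codebook N m F)) ⊆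
        ({R | G.used R = U ∧ ∃ E ∈ T U (encode (G.cand U g)),
          ¬ G.SafeAt (encode (G.cand U g)) R E} : Finset (Codebook N m F)) := by
      intro R hR
      obtain ⟨hU, hR⟩ := (Finset.mem_filter.1 hR).2
      refine Finset.mem_filter.2 ⟨Finset.mem_univ _, hU, ?_⟩
      rw [← hU, G.cand_used]
      exact hR
    have hc := Nat.le_trans (Nat.mul_le_mul_right (Fintype.card F) (Finset.card_le_card hs))
      (Nat.le_trans (G.card_not_safe U _ (G.finrank_cand U g) (T U (encode (G.cand U g))))
      (Nat.mul_le_mul_right _ (Nat.mul_le_mul (hT U _)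
        (Nat.mul_le_mul_left _ (G.card_cand_le U g)))))
    convert hc
  have h₂ : prob (G.law noise) {ω | ω.1 ∈ S} ≤ (G.edges.card : ℝ) ^ 3 / Fintype.card F := by
    have hΩ : (0 : ℝ) < Fintype.card (Codebook N m F) := by exact_mod_cast Fintype.card_pos
    rw [G.prob_codebook, div_le_div_iff₀ hΩ hq]
    have hc : (S.card * Fintype.card F : ℝ) ≤
        (G.edges.card ^ 3 * Fintype.card (Codebook N m F) : ℕ) := by
      rw [← Nat.cast_mul]
      exact Nat.cast_le.2 G.card_not_generic
    rwa [Nat.cast_mul, Nat.cast_pow] at hc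
  calc _ ≤ _ := prob_mono _ hsub
    _ ≤ _ := prob_union_le _ _ _
    _ ≤ _ := add_le_add h₁ h₂
    _ = _ := by rw [add_div]

end

/-- The bound for the cost, where `Q` stands for the squared logarithm of the number `n` of
edges. -/
theorem totalCost_le {κ Q : ℝ} {N C n l : ℕ} (hQ : 1 ≤ 4 * Q) (hn : 2 ≤ n) (hN₁ : 1 ≤ N)
    (hN : N ≤ n + 1) (hl : (l : ℝ) ≤ κ ^ 2 * n ^ 2 * Q) :
    (totalCost N C n l : ℝ) ≤ (50 + 50 * κ ^ 2) * (Q * (n : ℝ) ^ 4 * N * C) := by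
  simp only [totalCost, nodeCost, findCost, testCost]
  push_cast
  have hx : (2 : ℝ) ≤ n := by exact_mod_cast hn
  have hy : (1 : ℝ) ≤ N := by exact_mod_cast hN₁
  have hyx : (N : ℝ) ≤ 2 * n := by
    have : (N : ℝ) ≤ n + 1 := by exact_mod_cast hN
    linarith
  have hc : (0 : ℝ) ≤ C := Nat.cast_nonneg C
  generalize (n : ℝ) = x at *
  generalize (N : ℝ) = y at *
  generalize (C : ℝ) = c at *
  generalize (l : ℝ) = l at *
  have hQ0 : 0 ≤ Q := by linarith
  have hx0 : 0 ≤ x := by linarith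
  have hy0 : 0 ≤ y := by linarith
  have hk := sq_nonneg κ
  have htest : x * (2 * c) + l * (5 * c) ≤ c * (x ^ 2 * Q * (4 + 5 * κ ^ 2)) := by
    have h1 : 2 * x ≤ 4 * (x ^ 2 * Q) := by
      nlinarith [mul_le_mul_of_nonneg_left hQ (sq_nonneg x), mul_le_mul_of_nonneg_left hx hx0]
    have h2 : 2 * x + 5 * l ≤ x ^ 2 * Q * (4 + 5 * κ ^ 2) := by linarith
    linarith [mul_le_mul_of_nonneg_left h2 hc]
  generalize x * (2 * c) + l * (5 * c) = a at *
  have hnode : x * (x * (4 * c)) + y * a ≤ c * (x ^ 3 * Q * (16 + 10 * κ ^ 2)) := by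
    have h1 : y * a ≤ 2 * x * (c * (x ^ 2 * Q * (4 + 5 * κ ^ 2))) :=
      (mul_le_mul_of_nonneg_left htest hy0).trans
        (mul_le_mul_of_nonneg_right hyx (by positivity))
    have h2 : x ^ 2 ≤ 2 * (x ^ 3 * Q) := by
      nlinarith [mul_le_mul_of_nonneg_left hQ (pow_nonneg hx0 3),
        mul_le_mul_of_nonneg_left hx (sq_nonneg x)]
    linarith [mul_le_mul_of_nonneg_left h2 hc]
  generalize x * (x * (4 * c)) + y * a = b at *
  have hround : y * b + y * b * x ≤ 2 * x * (y * (c * (x ^ 3 * Q * (16 + 10 * κ ^ 2)))) := by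
    have h1 := mul_le_mul_of_nonneg_left hnode hy0
    have h2 : (1 + x) * (y * b) ≤ (1 + x) * (y * (c * (x ^ 3 * Q * (16 + 10 * κ ^ 2)))) :=
      mul_le_mul_of_nonneg_left h1 (by linarith)
    have h3 : (1 + x) * (y * (c * (x ^ 3 * Q * (16 + 10 * κ ^ 2)))) ≤
        2 * x * (y * (c * (x ^ 3 * Q * (16 + 10 * κ ^ 2)))) :=
      mul_le_mul_of_nonneg_right (by linarith) (by positivity)
    linarith
  have hfind : (a + y * (x * (x * (2 * c)))) * x ≤ y * c * x ^ 4 * Q * (12 + 5 * κ ^ 2) := by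
    have h1 : a * x ≤ c * (x ^ 2 * Q * (4 + 5 * κ ^ 2)) * x := mul_le_mul_of_nonneg_right htest hx0
    have h2 : 1 * (c * (x ^ 3 * Q * (4 + 5 * κ ^ 2))) ≤
        (y * x) * (c * (x ^ 3 * Q * (4 + 5 * κ ^ 2))) :=
      mul_le_mul_of_nonneg_right (by nlinarith) (by positivity)
    have h3 : (2 * (y * c * x ^ 3)) * 1 ≤ (2 * (y * c * x ^ 3)) * (x * (4 * Q)) :=
      mul_le_mul_of_nonneg_left (by nlinarith) (by positivity)
    linarith
  have hpos : 0 ≤ y * c * x ^ 4 * Q := by positivity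
  have hposk : 0 ≤ y * c * x ^ 4 * Q * κ ^ 2 := by positivity
  linarith

/-- The bound for the numerator of the error probability, where `Q` stands for the squared logarithm
of the number `n` of edges. -/
theorem failCount_le {κ Q : ℝ} {N n t : ℕ} (hQ : 1 ≤ 4 * Q) (hn : 2 ≤ n) (hN₁ : 1 ≤ N)
    (hN : N ≤ n + 1) (ht : (t : ℝ) * t ≤ κ ^ 2 * n ^ 2 * Q) :
    ((n : ℝ) + 1) * (N * N * (t * t)) + (n : ℝ) ^ 3 ≤
      (50 + 50 * κ ^ 2) * (Q * (n : ℝ) ^ 4 * N) := by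
  have hx : (2 : ℝ) ≤ n := by exact_mod_cast hn
  have hy : (1 : ℝ) ≤ N := by exact_mod_cast hN₁
  have hyx : (N : ℝ) ≤ 2 * n := by
    have : (N : ℝ) ≤ n + 1 := by exact_mod_cast hN
    linarith
  generalize (n : ℝ) = x at *
  generalize (N : ℝ) = y at *
  have hQ0 : 0 ≤ Q := by linarith
  have hx0 : 0 ≤ x := by linarith
  have hy0 : 0 ≤ y := by linarith
  have h1 : (x + 1) * (y * y * (t * t)) ≤ (2 * x) * (y * (2 * x) * (κ ^ 2 * x ^ 2 * Q)) := by
    gcongr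
    linarith
  have h2 : x ^ 3 * 1 ≤ x ^ 3 * (x * y * (4 * Q)) := by
    refine mul_le_mul_of_nonneg_left ?_ (by positivity)
    have : 1 ≤ x * y := by nlinarith
    nlinarith
  have hpos : 0 ≤ y * x ^ 4 * Q := by positivity
  have hposk : 0 ≤ y * x ^ 4 * Q * κ ^ 2 := by positivity
  linarith

end FindTopo

theorem mainTheorem9 (κ : ℝ) (hκ : 0 < κ) :
    ∃ K : ℝ, 0 < K ∧
      ∀ (F : Type) [Field F] [Fintype F] [DecidableEq F] (N m C k t : ℕ)
        (G : FindTopo.Network N m C)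
        (noise : FindTopo.Codebook N m F → PMF (Fin t → FindTopo.Generation N m C k F))
        (B δ : ℝ),
        (t : ℝ) ≤ κ * (G.edges.card * Real.log G.edges.card) →
        B = K * (Real.log G.edges.card ^ 2 * (G.edges.card : ℝ) ^ 4 * (N : ℝ) * (C : ℝ)) →
        δ = K * (Real.log G.edges.card ^ 2 * (G.edges.card : ℝ) ^ 4 * (N : ℝ))
          / (Fintype.card F : ℝ) →
        1 - δ ≤ FindTopo.prob (G.law noise) {ω | ω ∈ G.completeEvent → ω ∈ G.recoverEvent B} ∧
          (0 < FindTopo.prob (G.law noise) G.completeEvent →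
            1 - δ / FindTopo.prob (G.law noise) G.completeEvent ≤
              FindTopo.prob (G.law noise) (G.recoverEvent B ∩ G.completeEvent) /
                FindTopo.prob (G.law noise) G.completeEvent) := by
  refine ⟨50 + 50 * κ ^ 2, by positivity, ?_⟩
  intro F _ _ _ N m C k t G noise B δ ht hB hδ
  have hfail : FindTopo.prob (G.law noise) (G.completeEvent \ G.recoverEvent B) ≤ δ := by
    rcases G.one_le_edges.eq_or_lt with h1 | h2
    · -- With a single edge the logarithm vanishes: there are no generations and no candidates.
      have ht0 : t = 0 := by
        rw [← h1] at ht
        simpa using ht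
      have hempty : G.completeEvent \ G.recoverEvent B ⊆
          (∅ : Set (FindTopo.Codebook N m F × (Fin t → FindTopo.Generation N m C k F))) :=
        fun ω hω => absurd (FindTopo.Network.CandComplete.generations_pos
          (show G.CandComplete ω.1 ω.2 from hω.1)) (by omega)
      refine (FindTopo.prob_mono _ hempty).trans ?_
      rw [hδ, FindTopo.prob, MeasureTheory.measure_empty, ENNReal.toReal_zero]
      positivity
    -- From two edges on, the squared logarithm is at least `1 / 4`, so that it can be inserted into
    -- the terms of lower order.
    · have hlog : 1 / 2 ≤ Real.log G.edges.card := by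
        have h3 : Real.log 2 ≤ Real.log G.edges.card :=
          Real.log_le_log (by norm_num) (by exact_mod_cast h2)
        linarith [Real.log_two_gt_d9]
      have hQ : 1 ≤ 4 * Real.log G.edges.card ^ 2 := by nlinarith
      have htt : (t : ℝ) * t ≤
          κ ^ 2 * (G.edges.card : ℝ) ^ 2 * Real.log G.edges.card ^ 2 := by
        calc (t : ℝ) * t ≤ _ := mul_self_le_mul_self (Nat.cast_nonneg t) ht
          _ = _ := by ring
      refine (G.prob_fail_le noise B fun l hl => ?_).trans ?_
      · rw [hB]
        refine FindTopo.totalCost_le hQ h2 G.one_le_nodes G.nodes_le (le_trans ?_ htt)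
        exact_mod_cast hl
      · rw [hδ]
        gcongr
        exact FindTopo.failCount_le hQ h2 G.one_le_nodes G.nodes_le htt
  constructor
  · have hcover : (Set.univ : Set (FindTopo.Codebook N m F ×
        (Fin t → FindTopo.Generation N m C k F))) ⊆
        {ω | ω ∈ G.completeEvent → ω ∈ G.recoverEvent B} ∪
          (G.completeEvent \ G.recoverEvent B) := by
      intro ω _
      by_cases h : ω ∈ G.completeEvent → ω ∈ G.recoverEvent B
      · exact .inl h
      · exact .inr (Classical.not_imp.1 h)
    have h := (FindTopo.prob_mono (G.law noise) hcover).trans (FindTopo.prob_union_le _ _ _)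
    rw [FindTopo.prob_univ] at h
    linarith
  · intro hpos
    have hcover : (G.completeEvent : Set (FindTopo.Codebook N m F ×
        (Fin t → FindTopo.Generation N m C k F))) ⊆ (G.recoverEvent B ∩ G.completeEvent) ∪
        (G.completeEvent \ G.recoverEvent B) := by
      intro ω hω
      by_cases h : ω ∈ G.recoverEvent B
      · exact .inl ⟨h, hω⟩
      · exact .inr ⟨hω, h⟩
    have h := (FindTopo.prob_mono (G.law noise) hcover).trans (FindTopo.prob_union_le _ _ _)
    rw [one_sub_div hpos.ne', div_le_div_iff_of_pos_right hpos]
    linarith
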